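/- Let $A,B\in\mathbb C^{n\times n}$ be such that the pencil $A-\lambda B$ is singular ($\det(A-\lambda B)\equiv 0$), of normal rank $\max_{\zeta\in\mathbb C}\operatorname{rank}(A-\zeta B)=n-k$. A point $\mu\in\mathbb C\cup\{\infty\}$ is an eigenvalue of a pencil $C-\lambda D$ if $\operatorname{rank}(C-\mu D)$ (for $\mu=\infty$: $\operatorname{rank} D$) is smaller than its normal rank. Let $D_A=\operatorname{diag}(a_1,\dots,a_k)$ and $D_B=\operatorname{diag}(b_1,\dots,b_k)$ be complex diagonal matrices such that $D_A-\lambda D_B$ is regular, and put $\gamma_i=a_i/b_i\in\mathbb C\cup\{\infty\}$ ($\gamma_i=\infty$ if $b_i=0$). Assume that no $\gamma_i$ is an eigenvalue of $A-\lambda B$ and that $\gamma_1,\dots,\gamma_k$ are pairwise distinct (the prescribed eigenvalues are simple). For $U,V\in\mathbb C^{n\times k}$ of full column rank and $\tau\in\mathbb C\setminus\{0\}$ put $$\widetilde A=A+\tau\,UD_AV^*,\qquad \widetilde B=B+\tau\,UD_BV^*.$$ The $\gamma_i$ are called the prescribed eigenvalues; a random eigenvalue is a point of $\mathbb C\cup\{\infty\}$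 that is an eigenvalue of $\widetilde A-\lambda\widetilde B$ for some $\tau\ne0$, but is neither an eigenvalue of $A-\lambda B$ nor one of the $\gamma_i$. Then the following holds generically with respect to the entries of $U$ and $V^*$, that is, whenever $(U,V^*)$ lies outside a certain proper algebraic subset of $\mathbb C^{2nk}$ that depends only on $A,B,D_A,D_B$. Every random eigenvalue is finite. For every finite prescribed eigenvalue and every random eigenvalue $\lambda_i$ there are a constant $c_i>0$ that does not depend on $\tau$, and vectors $x_i(\tau),y_i(\tau)$, such that for every $\tau\neq0$: - $x_i(\tau)$ and $y_i(\tau)$ are, uniquely up to scalar factors, the right and the left eigenvector of $\widetilde A-\lambda\widetilde B$ for $\lambda_i$ (that is, $x_i,y_i\ne0$, $(\widetilde A-\lambda_i\widetilde B)x_i=0$, $y_i^*(\widetilde A-\lambda_i\widetilde B)=0$); - $|s(\lambda_i)|=|y_i(\tau)^*\widetilde B\,x_i(\tau)|=c_i|\tau|$, and consequently any right and left eigenvectors $x',y'$ for $\lambda_i$ of Euclidean norm $1$ satisfy $|y'^*\widetilde B x'|=c_i|\tau|/(\|x_i(\tau)\|\,\|y_i(\tau)\|)$. Here the eigenvectors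 are scaled as follows. If $\lambda_i$ is prescribed, then $x_i$ and $y_i$ are unit vectors that do not depend on $\tau$ (so that $|s(\lambda_i)|=c_i|\tau|$ for all unit eigenvectors). If $\lambda_i$ is random, then either $x_i$ is a unit vector independent of $\tau$ with $V^*x_i=0$ and $y_i(\tau)=w+\overline{\tau}z$ with fixed vectors $w,z$, $\|w\|=1$; or $y_i$ is a unit vector independent of $\tau$ with $U^*y_i=0$ and $x_i(\tau)=w+\tau z$ with fixed vectors $w,z$, $\|w\|=1$. -/

import Mathlib

open scoped Matrix ComplexConjugate

noncomputable section

namespace SingPencil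

/-- The Euclidean norm of a vector in `ℂⁿ`. -/
def euclNorm {n : ℕ} (x : Fin n → ℂ) : ℝ := ‖WithLp.toLp 2 x‖

/-- The pencil `A - z B` is regular: `det (A - z B)` does not vanish identically. -/
def IsRegular {n : ℕ} (A B : Matrix (Fin n) (Fin n) ℂ) : Prop :=
  ∃ z : ℂ, (A - z • B).det ≠ 0

/-- The normal rank of the pencil `A - z B`: the maximal rank of `A - ζ B` over all `ζ ∈ ℂ`
(a supremum of natural numbers that are at most `n`). -/
def nrank {n : ℕ} (A B : Matrix (Fin n) (Fin n) ℂ) : ℕ :=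
  ⨆ ζ : ℂ, (A - ζ • B).rank

/-- The (finite or infinite) eigenvalues of a possibly singular pencil `A - z B`: the points of
`ℂ ∪ {∞}` where the rank drops below the normal rank. -/
def IsEigenvalue {n : ℕ} (A B : Matrix (Fin n) (Fin n) ℂ) (μ : OnePoint ℂ) : Prop :=
  (μ = OnePoint.infty ∧ B.rank < nrank A B) ∨
    ∃ z : ℂ, μ = (z : OnePoint ℂ) ∧ (A - z • B).rank < nrank A B

/-- `x` is a right eigenvector of `A - z B` for the finite value `z`. -/
def IsRightEigenvector {n : ℕ} (A B : Matrix (Fin n) (Fin n) ℂ) (z : ℂ) (x : Fin n → ℂ) : Prop :=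
  x ≠ 0 ∧ (A - z • B) *ᵥ x = 0

/-- `y` is a left eigenvector of `A - z B` for the finite value `z`: `y^* (A - z B) = 0`. -/
def IsLeftEigenvector {n : ℕ} (A B : Matrix (Fin n) (Fin n) ℂ) (z : ℂ) (y : Fin n → ℂ) : Prop :=
  y ≠ 0 ∧ star y ᵥ* (A - z • B) = 0

/-- The perturbed matrix `C + τ U diag(d) V^*`. -/
def perturbed {n k : ℕ} (C : Matrix (Fin n) (Fin n) ℂ) (U V : Matrix (Fin n) (Fin k) ℂ)
    (d : Fin k → ℂ) (τ : ℂ) : Matrix (Fin n) (Fin n) ℂ :=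
  C + τ • (U * Matrix.diagonal d * Vᴴ)

/-- The value `a_i / b_i ∈ ℂ ∪ {∞}`, an eigenvalue of `diag(a) - z diag(b)`. -/
def gamma {k : ℕ} (a b : Fin k → ℂ) (i : Fin k) : OnePoint ℂ :=
  if b i = 0 then OnePoint.infty else ((a i / b i : ℂ) : OnePoint ℂ)

/-- The random eigenvalues: those eigenvalues of the perturbed pencil (for some `τ ≠ 0`) that are
neither eigenvalues of the original pencil nor prescribed ones. -/
def IsRandom {n k : ℕ} (A B : Matrix (Fin n) (Fin n) ℂ) (U V : Matrix (Fin n) (Fin k) ℂ)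
    (a b : Fin k → ℂ) (μ : OnePoint ℂ) : Prop :=
  (∃ τ : ℂ, τ ≠ 0 ∧ IsEigenvalue (perturbed A U V a τ) (perturbed B U V b τ) μ) ∧
    ¬ IsEigenvalue A B μ ∧ ∀ i, gamma a b i ≠ μ

/-- The number `y^* B x`. -/
def sValue {n : ℕ} (B : Matrix (Fin n) (Fin n) ℂ) (x y : Fin n → ℂ) : ℂ :=
  star y ⬝ᵥ (B *ᵥ x)

/-- The common zero set of finitely many complex polynomials. -/
def IsAlgebraicSet {σ : Type} (S : Set (σ → ℂ)) : Prop :=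
  ∃ P : Finset (MvPolynomial σ ℂ), S = {v | ∀ p ∈ P, MvPolynomial.eval v p = 0}

/-- A set is generic if its complement is contained in a proper algebraic set. -/
def IsGeneric {σ : Type} (Ω : Set (σ → ℂ)) : Prop :=
  ∃ S : Set (σ → ℂ), IsAlgebraicSet S ∧ S ≠ Set.univ ∧ Ωᶜ ⊆ S

/-- The entries of `U` and of `W`, as one vector in `ℂ^(2nk)`. -/
def entries {n k : ℕ} (U : Matrix (Fin n) (Fin k) ℂ) (W : Matrix (Fin k) (Fin n) ℂ) :
    (Fin n × Fin k) ⊕ (Fin k × Fin n) → ℂ :=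
  Sum.elim (fun p => U p.1 p.2) (fun p => W p.1 p.2)

/-- `P U V` holds generically with respect to the entries of `U` and `V^*`. -/
def Generically {n k : ℕ}
    (P : Matrix (Fin n) (Fin k) ℂ → Matrix (Fin n) (Fin k) ℂ → Prop) : Prop :=
  ∃ Ω : Set ((Fin n × Fin k) ⊕ (Fin k × Fin n) → ℂ), IsGeneric Ω ∧
    ∀ U V : Matrix (Fin n) (Fin k) ℂ, entries U Vᴴ ∈ Ω → P U V

/-- For every `τ ≠ 0`, the vectors `x τ` and `y τ` are the right and left eigenvectors of the
perturbed pencil `Ã(τ) - z B̃(τ)` for the finite eigenvalue `lam`, unique up to scaling;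
`|y(τ)^* B̃(τ) x(τ)| = c |τ|`; and for every pair of unit eigenvectors `x'`, `y'` one has
`|y'^* B̃(τ) x'| = c |τ| / (‖x(τ)‖ ‖y(τ)‖)`. -/
def SLaw {n : ℕ} (At Bt : ℂ → Matrix (Fin n) (Fin n) ℂ) (lam : ℂ)
    (x y : ℂ → Fin n → ℂ) (c : ℝ) : Prop :=
  ∀ τ : ℂ, τ ≠ 0 →
    IsRightEigenvector (At τ) (Bt τ) lam (x τ) ∧
    IsLeftEigenvector (At τ) (Bt τ) lam (y τ) ∧
    (∀ x', IsRightEigenvector (At τ) (Bt τ) lam x' → ∃ r : ℂ, x' = r • x τ) ∧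
    (∀ y', IsLeftEigenvector (At τ) (Bt τ) lam y' → ∃ r : ℂ, y' = r • y τ) ∧
    ‖sValue (Bt τ) (x τ) (y τ)‖ = c * ‖τ‖ ∧
    ∀ x' y', IsRightEigenvector (At τ) (Bt τ) lam x' → euclNorm x' = 1 →
      IsLeftEigenvector (At τ) (Bt τ) lam y' → euclNorm y' = 1 →
      ‖sValue (Bt τ) x' y'‖ = c * ‖τ‖ / (euclNorm (x τ) * euclNorm (y τ))

end SingPencil

end

noncomputable section

namespace SingPencil

open Matrix Polynomial

/-! ### Determinants and kernels -/

/-! Write `W` for `Vᴴ`, and let `M = A - lam • B` have rank `n - k`. If all `a i - lam * b i` are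
nonzero and `τ ≠ 0`, the perturbed matrix is singular at `lam` only if `M` has a right null vector
killed by `W` or a left null vector killed by `U` (`exists_null_vector_of_det_updated_eq_zero`).
This condition is free of `τ` and forces the bordered matrix `[M U; W 0]` to be singular. So random
eigenvalues are zeros of one bordered determinant, a polynomial in `lam` and the entries of `U`,
`W`.

That determinant is affine in every border entry, so a square factor cannot involve the border. A
Bertini argument (`exists_ne_zero_forall_simple_root`) then shows that for a generic border its
zeros away from the eigenvalues of `A - z B` are simple. By Jacobi's formula, the null vectors `l`,
`r` of the bordered matrix at such a zero are unique up to scaling, and `B`, padded by zeros, pairs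
them nontrivially.

In contrast, `y B x = 0` for all left and right null vectors `y`, `x` of `M`
(`dotProduct_mulVec_eq_zero`). Suppose `r = (x, 0)` and `l = (ζ, q)`. Choosing a left null vector
`ω` of `M` with `d * (ω U) = q`, where `d = a - lam • b`, gives the left eigenvector `ω + τ ζ`. Its
pairing with `x` is `τ (ζ B x)`: the constant term vanishes and the coefficient of `τ` does not. The
other random case is the transpose.

At a prescribed `lam = a i / b i`, the null vectors of `M` with `W x = e_i` and `y U = e_i` are
eigenvectors for every `τ`, and the pairing is `τ * b i`. -/

/-- Jacobi's formula for the derivative of the determinant. -/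
theorem hasDerivAt_det {ι : Type*} [Fintype ι] [DecidableEq ι] {G : ℂ → Matrix ι ι ℂ}
    {H : Matrix ι ι ℂ} {z : ℂ} (hG : ∀ i j, HasDerivAt (fun t => G t i j) (H i j) z) :
    HasDerivAt (fun t => (G t).det) ((G z).adjugate * H).trace z := by
  -- By Cramer, the `i`-th diagonal entry is the determinant of `G z` with column `i` replaced by
  -- that of `H`; summing over `i` gives the Leibniz expansion differentiated factor by factor.
  have key : ((G z).adjugate * H).trace = ∑ σ : Equiv.Perm ι, (Equiv.Perm.sign σ : ℤ) •
      ∑ i, (∏ j ∈ Finset.univ.erase i, G z (σ j) j) • H (σ i) i := by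
    simp only [Finset.smul_sum]
    rw [Finset.sum_comm, Matrix.trace]
    refine Finset.sum_congr rfl fun i _ => ?_
    have : ((G z).adjugate * H).diag i = ((G z).updateCol i (fun r => H r i)).det := by
      rw [← Matrix.cramer_apply, Matrix.cramer_eq_adjugate_mulVec]
      rfl
    rw [this, Matrix.det_apply]
    refine Finset.sum_congr rfl fun σ _ => ?_
    rw [← Finset.mul_prod_erase _ _ (Finset.mem_univ i)]
    congr 1
    rw [smul_eq_mul, mul_comm]
    congr 1
    · refine Finset.prod_congr rfl fun j hj => ?_
      rw [Matrix.updateCol_ne (Finset.ne_of_mem_erase hj)]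
    · simp
  rw [key]
  simp only [Matrix.det_apply]
  refine HasDerivAt.fun_sum fun σ _ => ?_
  have h := HasDerivAt.fun_finsetProd (u := Finset.univ) (x := z)
    (f := fun i t => G t (σ i) i) (f' := fun i => H (σ i) i) fun i _ => hG (σ i) i
  exact h.const_smul ((Equiv.Perm.sign σ : ℤˣ) : ℤ)

/-- A nonzero adjugate bounds the dimension of the kernel by one. -/
theorem eq_smul_of_adjugate_ne_zero {ι : Type*} [Fintype ι] [DecidableEq ι] {G : Matrix ι ι ℂ}
    {i j : ι} (hij : G.adjugate i j ≠ 0) {r v : ι → ℂ} (hr0 : r ≠ 0) (hr : G *ᵥ r = 0)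
    (hv : G *ᵥ v = 0) : r i ≠ 0 ∧ v = (v i / r i) • r := by
  -- The adjugate entry is the determinant of `G` with row `j` replaced by `e_i`; this invertible
  -- matrix kills `w`.
  have inj : ∀ w : ι → ℂ, G *ᵥ w = 0 → w i = 0 → w = 0 := by
    intro w hw hwi
    rw [Matrix.adjugate_apply] at hij
    refine Matrix.eq_zero_of_mulVec_eq_zero hij ?_
    ext a
    by_cases ha : a = j
    · subst ha
      simp [Matrix.mulVec, hwi]
    · simpa [Matrix.mulVec, Matrix.updateRow_ne ha] using congrFun hw a
  have hri : r i ≠ 0 := fun h => hr0 (inj r hr h)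
  refine ⟨hri, sub_eq_zero.mp (inj _ ?_ ?_)⟩
  · rw [Matrix.mulVec_sub, Matrix.mulVec_smul, hr, hv]; simp
  · simp [hri]

/-- At a simple zero of `det G` both kernels are one-dimensional and the derivative of `G` pairs
them nontrivially. -/
theorem kernels_of_trace_adjugate_mul_ne_zero {ι : Type*} [Fintype ι] [DecidableEq ι]
    {G H : Matrix ι ι ℂ} (hdet : G.det = 0) (htr : (G.adjugate * H).trace ≠ 0)
    {r l : ι → ℂ} (hr0 : r ≠ 0) (hr : G *ᵥ r = 0) (hl0 : l ≠ 0) (hl : l ᵥ* G = 0) :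
    (∀ v, G *ᵥ v = 0 → ∃ α : ℂ, v = α • r) ∧ (∀ v, v ᵥ* G = 0 → ∃ α : ℂ, v = α • l) ∧
      l ⬝ᵥ (H *ᵥ r) ≠ 0 := by
  have hadj : ∃ i j, G.adjugate i j ≠ 0 := by
    by_contra! h
    have : G.adjugate = 0 := by ext i j; exact h i j
    simp [this] at htr
  obtain ⟨i, j, hij⟩ := hadj
  have hijT : Gᵀ.adjugate j i ≠ 0 := by rwa [← Matrix.adjugate_transpose]
  have hlT : Gᵀ *ᵥ l = 0 := by rwa [Matrix.mulVec_transpose]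
  refine ⟨fun v hv => ⟨_, (eq_smul_of_adjugate_ne_zero hij hr0 hr hv).2⟩, fun v hv =>
    ⟨_, (eq_smul_of_adjugate_ne_zero hijT hl0 hlT (v := v) (by rwa [Matrix.mulVec_transpose])).2⟩,
    fun h0 => htr ?_⟩
  -- Since `G * adj G = 0`, every column of the adjugate is a multiple of `r`. Hence `adj G` is the
  -- outer product of `r` with a left null vector `s`, itself a multiple of `l`, and the trace
  -- becomes `s H r`.
  have hcol : ∀ b, ∃ α : ℂ, ∀ a, G.adjugate a b = α * r a := by
    intro b
    have h1 : G *ᵥ (fun a => G.adjugate a b) = 0 := by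
      have := Matrix.mul_adjugate G
      rw [hdet, zero_smul] at this
      ext a
      exact congrFun (congrFun this a) b
    refine ⟨_, fun a => congrFun (eq_smul_of_adjugate_ne_zero hij hr0 hr h1).2 a⟩
  choose s hs using hcol
  have hri := (eq_smul_of_adjugate_ne_zero hij hr0 hr hr).1
  have hsG : s ᵥ* G = 0 := by
    have := Matrix.adjugate_mul G
    rw [hdet, zero_smul] at this
    ext b
    have h2 := congrFun (congrFun this i) b
    simp only [Matrix.mul_apply, hs, Matrix.zero_apply] at h2
    have h3 : r i * (s ᵥ* G) b = 0 := by
      rw [← h2, Matrix.vecMul, dotProduct, Finset.mul_sum]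
      exact Finset.sum_congr rfl fun _ _ => by ring
    simpa [hri] using h3
  have hsl := (eq_smul_of_adjugate_ne_zero hijT hl0 hlT (v := s)
    (by rwa [Matrix.mulVec_transpose])).2
  have : (G.adjugate * H).trace = s ⬝ᵥ (H *ᵥ r) := by
    simp only [Matrix.trace, Matrix.diag, Matrix.mul_apply, dotProduct, Matrix.mulVec,
      Finset.mul_sum, hs]
    rw [Finset.sum_comm]
    exact Finset.sum_congr rfl fun _ _ => Finset.sum_congr rfl fun _ _ => by ring
  rw [this, hsl, smul_dotProduct, h0, smul_zero]

/-! ### Bordered matrices -/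

/-- The square matrix `C` bordered by the columns `U` and the rows `W`. -/
abbrev bordered {R : Type*} [Zero R] {n k : ℕ} (C : Matrix (Fin n) (Fin n) R)
    (U : Matrix (Fin n) (Fin k) R) (W : Matrix (Fin k) (Fin n) R) :
    Matrix (Fin n ⊕ Fin k) (Fin n ⊕ Fin k) R :=
  Matrix.fromBlocks C U W 0

section

variable {n k : ℕ} {C : Matrix (Fin n) (Fin n) ℂ} {U : Matrix (Fin n) (Fin k) ℂ}
  {W : Matrix (Fin k) (Fin n) ℂ}

theorem bordered_mulVec (x : Fin n → ℂ) (w : Fin k → ℂ) :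
    bordered C U W *ᵥ Sum.elim x w = Sum.elim (C *ᵥ x + U *ᵥ w) (W *ᵥ x) := by
  simp [bordered, Matrix.fromBlocks_mulVec]

theorem vecMul_bordered (y : Fin n → ℂ) (q : Fin k → ℂ) :
    Sum.elim y q ᵥ* bordered C U W = Sum.elim (y ᵥ* C + q ᵥ* W) (y ᵥ* U) := by
  simp [bordered, Matrix.vecMul_fromBlocks]

theorem sumElim_eq_zero {x : Fin n → ℂ} {w : Fin k → ℂ} :
    Sum.elim x w = 0 ↔ x = 0 ∧ w = 0 := by
  constructor
  · intro h
    exact ⟨funext fun i => congrFun h (Sum.inl i), funext fun i => congrFun h (Sum.inr i)⟩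
  · rintro ⟨rfl, rfl⟩
    ext (i | i) <;> rfl

theorem finrank_ker_add_rank (C : Matrix (Fin n) (Fin n) ℂ) :
    Module.finrank ℂ (LinearMap.ker C.mulVecLin) + C.rank = n := by
  have := LinearMap.finrank_range_add_finrank_ker C.mulVecLin
  rw [Module.finrank_fin_fun] at this
  rw [Matrix.rank]
  omega

/-- If `W` is injective on the kernel of `C`, whose dimension is at least `k`, it is onto there. -/
theorem exists_mem_ker_mulVec_eq (hC : C.rank + k ≤ n)
    (hinj : ∀ x, C *ᵥ x = 0 → W *ᵥ x = 0 → x = 0) (v : Fin k → ℂ) :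
    ∃ x, C *ᵥ x = 0 ∧ W *ᵥ x = v := by
  let f : LinearMap.ker C.mulVecLin →ₗ[ℂ] (Fin k → ℂ) := W.mulVecLin.domRestrict _
  have hf : Function.Injective f := by
    rw [← LinearMap.ker_eq_bot, LinearMap.ker_eq_bot']
    rintro ⟨x, hx⟩ hfx
    exact Subtype.ext (hinj x hx hfx)
  have h1 := LinearMap.finrank_le_finrank_of_injective hf
  have h2 := finrank_ker_add_rank C
  rw [Module.finrank_fin_fun] at h1
  have hs := (LinearMap.injective_iff_surjective_of_finrank_eq_finrank
    (f := f) (by rw [Module.finrank_fin_fun]; omega)).mp hf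
  obtain ⟨⟨x, hx⟩, h⟩ := hs v
  exact ⟨x, hx, h⟩

theorem exists_vecMul_eq_zero_vecMul_eq (hC : C.rank + k ≤ n)
    (hinj : ∀ y, y ᵥ* C = 0 → y ᵥ* U = 0 → y = 0) (v : Fin k → ℂ) :
    ∃ y, y ᵥ* C = 0 ∧ y ᵥ* U = v := by
  obtain ⟨y, h1, h2⟩ := exists_mem_ker_mulVec_eq (C := Cᵀ) (W := Uᵀ) (by rwa [Matrix.rank_transpose])
    (by simpa only [Matrix.mulVec_transpose] using hinj) v
  exact ⟨y, by rwa [Matrix.mulVec_transpose] at h1, by rwa [Matrix.mulVec_transpose] at h2⟩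

/-- If no left null vector of `C` is annihilated by `U`, the column spaces of `C` and `U` are
independent. -/
theorem eq_zero_of_mulVec_add_mulVec_eq_zero (hC : C.rank + k ≤ n)
    (hinj : ∀ y, y ᵥ* C = 0 → y ᵥ* U = 0 → y = 0) {x : Fin n → ℂ} {w : Fin k → ℂ}
    (h : C *ᵥ x + U *ᵥ w = 0) : C *ᵥ x = 0 ∧ w = 0 := by
  have hw : w = 0 := by
    ext i
    -- Pairing the relation with this `y` kills the `C` term and reads off `w i`.
    obtain ⟨y, h1, h2⟩ := exists_vecMul_eq_zero_vecMul_eq hC hinj (Pi.single i 1)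
    have := congrArg (fun t => y ⬝ᵥ t) h
    simp only [dotProduct_add, Matrix.dotProduct_mulVec, h1, h2, zero_dotProduct, zero_add,
      dotProduct_zero, single_dotProduct, one_mul] at this
    exact this
  subst hw
  simpa using h

theorem det_bordered_ne_zero_iff :
    (bordered C U W).det ≠ 0 ↔ ∀ x w, C *ᵥ x + U *ᵥ w = 0 → W *ᵥ x = 0 → x = 0 ∧ w = 0 := by
  rw [ne_eq, ← Matrix.exists_mulVec_eq_zero_iff]
  constructor
  · intro h x w h1 h2
    by_contra h3
    refine h ⟨Sum.elim x w, fun h4 => h3 (sumElim_eq_zero.mp h4), ?_⟩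
    rw [bordered_mulVec, h1, h2, sumElim_eq_zero]
    exact ⟨rfl, rfl⟩
  · rintro h ⟨v, hv0, hv⟩
    obtain ⟨x, w, rfl⟩ : ∃ x w, v = Sum.elim x w := ⟨v ∘ Sum.inl, v ∘ Sum.inr, by simp⟩
    rw [bordered_mulVec, sumElim_eq_zero] at hv
    exact hv0 (sumElim_eq_zero.mpr (h x w hv.1 hv.2))

theorem eq_zero_of_mulVec_eq_zero_of_det_bordered (h : (bordered C U W).det ≠ 0) (x : Fin n → ℂ)
    (h1 : C *ᵥ x = 0) (h2 : W *ᵥ x = 0) : x = 0 :=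
  (det_bordered_ne_zero_iff.mp h x 0 (by simpa using h1) h2).1

theorem bordered_transpose : (bordered C U W)ᵀ = bordered Cᵀ Wᵀ Uᵀ := by
  simp [bordered, Matrix.fromBlocks_transpose]

theorem eq_zero_of_vecMul_eq_zero_of_det_bordered (h : (bordered C U W).det ≠ 0) (y : Fin n → ℂ)
    (h1 : y ᵥ* C = 0) (h2 : y ᵥ* U = 0) : y = 0 := by
  rw [← Matrix.det_transpose, bordered_transpose] at h
  refine eq_zero_of_mulVec_eq_zero_of_det_bordered h y ?_ ?_ <;> rwa [Matrix.mulVec_transpose]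

theorem det_bordered_ne_zero (hC : C.rank + k ≤ n)
    (hr : ∀ x, C *ᵥ x = 0 → W *ᵥ x = 0 → x = 0)
    (hl : ∀ y, y ᵥ* C = 0 → y ᵥ* U = 0 → y = 0) : (bordered C U W).det ≠ 0 := by
  rw [det_bordered_ne_zero_iff]
  intro x w h1 h2
  obtain ⟨h3, h4⟩ := eq_zero_of_mulVec_add_mulVec_eq_zero hC hl h1
  exact ⟨hr x h3 h2, h4⟩

/-- `W` embeds the kernel of `C` into a space of dimension `k`. -/
theorem le_rank_add_of_det_bordered_ne_zero (h : (bordered C U W).det ≠ 0) : n ≤ C.rank + k := by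
  let f : LinearMap.ker C.mulVecLin →ₗ[ℂ] (Fin k → ℂ) := W.mulVecLin.domRestrict _
  have hf : Function.Injective f := by
    rw [← LinearMap.ker_eq_bot, LinearMap.ker_eq_bot']
    rintro ⟨x, hx⟩ hfx
    exact Subtype.ext (eq_zero_of_mulVec_eq_zero_of_det_bordered h x hx hfx)
  have h1 := LinearMap.finrank_le_finrank_of_injective hf
  have h2 := finrank_ker_add_rank C
  rw [Module.finrank_fin_fun] at h1
  omega

/-- Project onto the kernel, then identify it with `ℂ^k`. -/
theorem exists_injective_on_ker (C : Matrix (Fin n) (Fin n) ℂ) (hC : C.rank + k = n) :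
    ∃ W : Matrix (Fin k) (Fin n) ℂ, ∀ x, C *ᵥ x = 0 → W *ᵥ x = 0 → x = 0 := by
  have h := finrank_ker_add_rank C
  have e : LinearMap.ker C.mulVecLin ≃ₗ[ℂ] (Fin k → ℂ) :=
    LinearEquiv.ofFinrankEq _ _ (by rw [Module.finrank_fin_fun]; omega)
  obtain ⟨g, hg⟩ := (LinearMap.ker C.mulVecLin).subtype.exists_leftInverse_of_injective
    (Submodule.ker_subtype _)
  refine ⟨LinearMap.toMatrix' (e.toLinearMap ∘ₗ g), fun x h1 h2 => ?_⟩
  rw [LinearMap.toMatrix'_mulVec] at h2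
  have h3 : g x = 0 := by simpa using h2
  have h4 := LinearMap.congr_fun hg ⟨x, h1⟩
  simp only [LinearMap.comp_apply, Submodule.subtype_apply, h3, LinearMap.id_apply] at h4
  exact congrArg Subtype.val h4.symm

theorem exists_det_bordered_ne_zero (C : Matrix (Fin n) (Fin n) ℂ) (hC : C.rank + k = n) :
    ∃ (U : Matrix (Fin n) (Fin k) ℂ) (W : Matrix (Fin k) (Fin n) ℂ),
      (bordered C U W).det ≠ 0 := by
  obtain ⟨W, hW⟩ := exists_injective_on_ker C hC
  obtain ⟨X, hX⟩ := exists_injective_on_ker Cᵀ (k := k) (by rwa [Matrix.rank_transpose])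
  refine ⟨Xᵀ, W, det_bordered_ne_zero hC.le hW fun y h1 h2 => hX y ?_ ?_⟩
  · rwa [Matrix.mulVec_transpose]
  · rwa [Matrix.vecMul_transpose] at h2

end

/-! ### Ranks of pencils -/

section

variable {n k : ℕ} {A B : Matrix (Fin n) (Fin n) ℂ}

theorem bddAbove_range_rank (A B : Matrix (Fin n) (Fin n) ℂ) :
    BddAbove (Set.range fun ζ : ℂ => (A - ζ • B).rank) :=
  ⟨n, by rintro _ ⟨ζ, rfl⟩; simpa using Matrix.rank_le_card_width (A - ζ • B)⟩

theorem rank_le_nrank (A B : Matrix (Fin n) (Fin n) ℂ) (z : ℂ) :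
    (A - z • B).rank ≤ nrank A B :=
  le_ciSup (bddAbove_range_rank A B) z

theorem exists_rank_eq_nrank (A B : Matrix (Fin n) (Fin n) ℂ) :
    ∃ z : ℂ, (A - z • B).rank = nrank A B :=
  Nat.sSup_mem (Set.range_nonempty _) (bddAbove_range_rank A B)

theorem nrank_le (A B : Matrix (Fin n) (Fin n) ℂ) : nrank A B ≤ n := by
  obtain ⟨z, hz⟩ := exists_rank_eq_nrank A B
  rw [← hz]
  simpa using Matrix.rank_le_card_width (A - z • B)

theorem continuous_bordered {X : Type*} [TopologicalSpace X] {C : X → Matrix (Fin n) (Fin n) ℂ}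
    (hC : Continuous C) (U : Matrix (Fin n) (Fin k) ℂ) (W : Matrix (Fin k) (Fin n) ℂ) :
    Continuous fun t => bordered (C t) U W :=
  hC.matrix_fromBlocks continuous_const continuous_const continuous_const

/-- The rank is lower semicontinuous: a nonsingular bordering of `B` stays nonsingular for `B - t •
A` with small `t ≠ 0`, and this matrix is a nonzero multiple of `A - t⁻¹ • B`. -/
theorem rank_right_le_nrank (A B : Matrix (Fin n) (Fin n) ℂ) : B.rank ≤ nrank A B := by
  have hBn : B.rank ≤ n := by simpa using Matrix.rank_le_card_width B
  obtain ⟨U, W, h⟩ := exists_det_bordered_ne_zero (k := n - B.rank) B (by omega)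
  have hc : Continuous fun t : ℂ => (bordered (B - t • A) U W).det :=
    (continuous_bordered (by fun_prop) U W).matrix_det
  have h0 : (fun t : ℂ => (bordered (B - t • A) U W).det) 0 ≠ 0 := by simpa using h
  have hev := (hc.continuousAt.eventually_ne h0).filter_mono
    (nhdsWithin_le_nhds (s := {0}ᶜ))
  obtain ⟨t, ht, ht0⟩ := (hev.and self_mem_nhdsWithin).exists
  have h1 := le_rank_add_of_det_bordered_ne_zero ht
  have h2 : (B - t • A).rank = (A - t⁻¹ • B).rank := by
    have : B - t • A = (-t) • (A - t⁻¹ • B) := by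
      rw [smul_sub, smul_smul]
      simp [show t ≠ 0 from ht0]
      abel
    rw [this, Matrix.rank_smul_of_mem_nonZeroDivisors _
      (mem_nonZeroDivisors_of_ne_zero (neg_ne_zero.mpr ht0))]
  have h3 := rank_le_nrank A B t⁻¹
  omega

/-- Null vectors at a point that is not an eigenvalue extend along the pencil, hence the
coefficient `B` pairs the two null spaces trivially. -/
theorem dotProduct_mulVec_eq_zero (hAB : nrank A B + k = n) {z : ℂ}
    (hz : (A - z • B).rank + k = n) {x y : Fin n → ℂ} (hx : (A - z • B) *ᵥ x = 0)
    (hy : y ᵥ* (A - z • B) = 0) : y ⬝ᵥ (B *ᵥ x) = 0 := by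
  obtain ⟨U, W, h⟩ := exists_det_bordered_ne_zero (k := k) (A - z • B) hz
  let G : ℂ → Matrix (Fin n ⊕ Fin k) (Fin n ⊕ Fin k) ℂ := fun t => bordered (A - t • B) U W
  have hGc : Continuous G := continuous_bordered (by fun_prop) U W
  let e : Fin n ⊕ Fin k → ℂ := Sum.elim 0 (W *ᵥ x)
  -- Using the adjugate instead of the inverse makes `X` continuous everywhere; `X z` is a nonzero
  -- multiple of `x`.
  let X : ℂ → Fin n → ℂ := fun t => ((G t).adjugate *ᵥ e) ∘ Sum.inl
  have hGX : ∀ t, G t *ᵥ ((G t).adjugate *ᵥ e) = (G t).det • e := by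
    intro t
    rw [Matrix.mulVec_mulVec, Matrix.mul_adjugate, Matrix.smul_mulVec, Matrix.one_mulVec]
  have hXc : Continuous X := by
    have : Continuous fun t => (G t).adjugate *ᵥ e :=
      hGc.matrix_adjugate.matrix_mulVec continuous_const
    exact continuous_pi fun i => (continuous_apply (Sum.inl i)).comp this
  have hfc : Continuous fun t => y ⬝ᵥ (B *ᵥ X t) :=
    Continuous.dotProduct continuous_const (continuous_const.matrix_mulVec hXc)
  have hXz : X z = (G z).det • x := by
    have h1 : G z *ᵥ Sum.elim x 0 = e := by
      simp only [G, e]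
      rw [bordered_mulVec, hx]
      simp
    have h2 : (G z).adjugate *ᵥ e = (G z).det • Sum.elim x 0 := by
      rw [← h1, Matrix.mulVec_mulVec, Matrix.adjugate_mul, Matrix.smul_mulVec,
        Matrix.one_mulVec]
    ext i
    simp [X, h2]
  -- Near `z` the vector `X t` is null for `A - t • B`, because the rank there is at most `n - k`.
  -- Pairing with `y` leaves `-(t - z) (y B X t) = 0`, and `t - z` cancels.
  have hev : ∀ᶠ t in nhdsWithin z {z}ᶜ, y ⬝ᵥ (B *ᵥ X t) = 0 := by
    have h1 := (hGc.matrix_det.continuousAt.eventually_ne h).filter_mono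
      (nhdsWithin_le_nhds (s := {z}ᶜ))
    filter_upwards [h1, self_mem_nhdsWithin] with t ht htz
    have h2 := hGX t
    have h3 : (G t).adjugate *ᵥ e = Sum.elim (X t) (((G t).adjugate *ᵥ e) ∘ Sum.inr) :=
      (Sum.elim_comp_inl_inr _).symm
    rw [h3] at h2
    simp only [G] at h2
    rw [bordered_mulVec] at h2
    have h4 : (A - t • B) *ᵥ X t + U *ᵥ (((G t).adjugate *ᵥ e) ∘ Sum.inr) = 0 := by
      ext i
      simpa [e] using congrFun h2 (Sum.inl i)
    have hrk : (A - t • B).rank + k ≤ n := by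
      have := rank_le_nrank A B t
      omega
    have h5 := (eq_zero_of_mulVec_add_mulVec_eq_zero hrk
      (eq_zero_of_vecMul_eq_zero_of_det_bordered ht) h4).1
    have h6 : A - t • B = (A - z • B) - (t - z) • B := by
      rw [sub_smul]; abel
    have h7 : y ⬝ᵥ ((A - t • B) *ᵥ X t) = -((t - z) * (y ⬝ᵥ (B *ᵥ X t))) := by
      rw [h6, Matrix.sub_mulVec, dotProduct_sub, Matrix.dotProduct_mulVec y (A - z • B), hy,
        zero_dotProduct, Matrix.smul_mulVec, dotProduct_smul, smul_eq_mul, zero_sub]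
    rw [h5, dotProduct_zero, eq_comm, neg_eq_zero] at h7
    exact (mul_eq_zero.mp h7).resolve_left (sub_ne_zero.mpr htz)
  have hlim : y ⬝ᵥ (B *ᵥ X z) = 0 :=
    tendsto_nhds_unique (hfc.continuousAt.tendsto.mono_left (nhdsWithin_le_nhds (s := {z}ᶜ)))
      (Filter.Tendsto.congr' (hev.mono fun t ht => ht.symm) tendsto_const_nhds)
  rw [hXz, Matrix.mulVec_smul, dotProduct_smul, smul_eq_mul] at hlim
  exact (mul_eq_zero.mp hlim).resolve_left h

end

/-! ### Simple roots of generic members of a family -/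

/-- Over a factorial domain of characteristic zero, a polynomial without nonconstant primitive
square factors is coprime to its derivative, up to a nonzero constant. -/
theorem exists_mul_add_mul_derivative_eq_C {R : Type*} [CommRing R] [IsDomain R] [CharZero R]
    [UniqueFactorizationMonoid R] (g : R[X])
    (hsq : ∀ q : R[X], q.IsPrimitive → q * q ∣ g → IsUnit q) :
    ∃ (P : R) (a b : R[X]), P ≠ 0 ∧ a * g + b * derivative g = C P := by
  classical
  let K := FractionRing R
  let : NormalizedGCDMonoid R := Nonempty.some inferInstance
  have : CharZero K := charZero_of_injective_algebraMap (FaithfulSMul.algebraMap_injective R K)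
  have hinj := map_injective (algebraMap R K) (FaithfulSMul.algebraMap_injective R K)
  have hg0 : g ≠ 0 := by
    rintro rfl
    have := hsq (X + 1) (by
      have : (X + 1 : R[X]).Monic := monic_X_add_C 1
      exact this.isPrimitive) (dvd_zero _)
    have h2 := natDegree_eq_zero_of_isUnit this
    rw [← C_1, natDegree_X_add_C] at h2
    exact one_ne_zero h2
  -- Gauss's lemma: a square factor over the fraction field has a primitive part whose square
  -- already divides `g` over `R`.
  have hsqf : Squarefree (g.map (algebraMap R K)) := by
    intro p hp
    have hp0 : p ≠ 0 := by
      rintro rfl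
      rw [zero_mul, zero_dvd_iff] at hp
      exact hg0 (hinj (by simpa using hp))
    obtain ⟨c, hc0, hc⟩ := IsLocalization.integerNormalization_spec (nonZeroDivisors R) p
    set N := IsLocalization.integerNormalization (nonZeroDivisors R) p
    refine isUnit_or_eq_zero_of_isUnit_integerNormalization_primPart (R := R) hp0
      (hsq _ N.isPrimitive_primPart ?_)
    refine (N.isPrimitive_primPart.mul
      N.isPrimitive_primPart).dvd_of_fraction_map_dvd_fraction_map (K := K) (dvd_trans ?_ hp)
    rw [Polynomial.map_mul]
    have hdvd : N.primPart.map (algebraMap R K) ∣ p := by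
      have hcK : algebraMap R K c ≠ 0 := by
        simpa using nonZeroDivisors.ne_zero hc0
      have h1 : p = C (algebraMap R K c)⁻¹ * N.map (algebraMap R K) := by
        rw [hc, ← algebraMap_smul K c p, Polynomial.smul_eq_C_mul, ← mul_assoc, ← C_mul,
          inv_mul_cancel₀ hcK, C_1, one_mul]
      rw [h1]
      refine Dvd.dvd.mul_left ?_ _
      conv_rhs => rw [N.eq_C_content_mul_primPart, Polynomial.map_mul]
      exact dvd_mul_left _ _
    exact mul_dvd_mul hdvd hdvd
  -- In characteristic zero squarefree means separable; clearing the denominators `c`, `d` of the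
  -- Bézout coefficients gives `P = c * d`.
  obtain ⟨a, b, hab⟩ := PerfectField.separable_iff_squarefree.mpr hsqf
  obtain ⟨c, hc0, hc⟩ := IsLocalization.integerNormalization_spec (nonZeroDivisors R) a
  obtain ⟨d, hd0, hd⟩ := IsLocalization.integerNormalization_spec (nonZeroDivisors R) b
  refine ⟨c * d, C d * IsLocalization.integerNormalization (nonZeroDivisors R) a,
    C c * IsLocalization.integerNormalization (nonZeroDivisors R) b,
    mul_ne_zero (nonZeroDivisors.ne_zero hc0) (nonZeroDivisors.ne_zero hd0), hinj ?_⟩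
  rw [Polynomial.map_add, Polynomial.map_mul, Polynomial.map_mul, Polynomial.map_mul,
    Polynomial.map_mul, hc, hd, ← derivative_map, map_C, map_C, map_C, map_mul, C_mul,
    ← algebraMap_smul K c a, ← algebraMap_smul K d b, Polynomial.smul_eq_C_mul,
    Polynomial.smul_eq_C_mul]
  linear_combination (C (algebraMap R K c) * C (algebraMap R K d)) * hab

section

variable {σ : Type}

/-- Evaluation of a family of polynomials at the point `z` and the parameter `u`. -/
def evalAt (z : ℂ) (u : σ → ℂ) : (MvPolynomial σ ℂ)[X] →+* ℂ :=
  eval₂RingHom (MvPolynomial.eval u) z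

/-- The shift of one parameter by a new variable. -/
def shiftHom [DecidableEq σ] (i : σ) : (MvPolynomial σ ℂ)[X] →+* (MvPolynomial σ ℂ)[X][X] :=
  eval₂RingHom (S := (MvPolynomial σ ℂ)[X][X])
    (MvPolynomial.eval₂Hom (S₁ := (MvPolynomial σ ℂ)[X][X]) ((C.comp C).comp MvPolynomial.C)
      (fun j => C (C (MvPolynomial.X j)) + if j = i then X else 0)) (C X)

@[simp] theorem shiftHom_X [DecidableEq σ] (i : σ) : shiftHom i X = C X := by
  simp [shiftHom]

@[simp] theorem shiftHom_C_C [DecidableEq σ] (i : σ) (c : ℂ) :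
    shiftHom i (C (MvPolynomial.C c)) = C (C (MvPolynomial.C c)) := by
  simp [shiftHom]

@[simp] theorem shiftHom_C_X [DecidableEq σ] (i j : σ) :
    shiftHom i (C (MvPolynomial.X j)) =
      C (C (MvPolynomial.X j)) + if j = i then X else 0 := by
  simp [shiftHom]

theorem evalAt_eq_eval_map (z : ℂ) (u : σ → ℂ) (p : (MvPolynomial σ ℂ)[X]) :
    evalAt z u p = (p.map (MvPolynomial.eval u)).eval z := by
  simp [evalAt, eval_map]

@[simp] theorem evalAt_C (z : ℂ) (u : σ → ℂ) (p : MvPolynomial σ ℂ) :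
    evalAt z u (C p) = MvPolynomial.eval u p := by
  simp [evalAt]

@[simp] theorem evalAt_X (z : ℂ) (u : σ → ℂ) : evalAt z u X = z := by
  simp [evalAt]

theorem evalAt_map_C (z : ℂ) (u : σ → ℂ) (p : ℂ[X]) :
    evalAt z u (p.map MvPolynomial.C) = p.eval z := by
  rw [evalAt_eq_eval_map, Polynomial.map_map]
  have : (MvPolynomial.eval u).comp MvPolynomial.C = RingHom.id ℂ := by ext; simp
  rw [this, Polynomial.map_id]

theorem eq_zero_of_evalAt {p : (MvPolynomial σ ℂ)[X]} (h : ∀ z u, evalAt z u p = 0) : p = 0 := by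
  ext1 m
  rw [coeff_zero]
  refine MvPolynomial.funext fun u => ?_
  have : p.map (MvPolynomial.eval u) = 0 := by
    refine Polynomial.funext fun z => ?_
    rw [← evalAt_eq_eval_map, h, eval_zero]
  rw [← coeff_map, this, coeff_zero, map_zero]

theorem eval₂_shiftHom [DecidableEq σ] (i : σ) (z t : ℂ) (u : σ → ℂ)
    (p : (MvPolynomial σ ℂ)[X]) :
    (shiftHom i p).eval₂ (evalAt z u) t = evalAt z (u + Pi.single i t) p := by
  have : (eval₂RingHom (evalAt z u) t).comp (shiftHom i) = evalAt z (u + Pi.single i t) := by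
    refine Polynomial.ringHom_ext' (MvPolynomial.ringHom_ext (fun c => ?_) fun j => ?_) ?_
    · simp [shiftHom]
    · by_cases h : j = i
      · subst h; simp [shiftHom]
      · simp [shiftHom, h]
    · simp [shiftHom]
  exact RingHom.congr_fun this p

theorem shiftHom_ne_zero [DecidableEq σ] (i : σ) {p : (MvPolynomial σ ℂ)[X]} (hp : p ≠ 0) :
    shiftHom i p ≠ 0 := by
  intro h
  refine hp (eq_zero_of_evalAt fun z u => ?_)
  have := eval₂_shiftHom i z 0 u p
  rw [h, eval₂_zero] at this
  simpa using this.symm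

theorem evalAt_add_single [DecidableEq σ] {i : σ} {p : (MvPolynomial σ ℂ)[X]}
    (h : (shiftHom i p).natDegree = 0) (z t : ℂ) (u : σ → ℂ) :
    evalAt z (u + Pi.single i t) p = evalAt z u p := by
  have h0 := eval₂_shiftHom i z 0 u p
  have h1 := eval₂_shiftHom i z t u p
  rw [eq_C_of_natDegree_eq_zero h, eval₂_C] at h0 h1
  rw [← h1, h0]
  simp

/-- The square root of a square factor of a family of degree at most one in each parameter does
not depend on the parameters. -/
theorem evalAt_eq_of_mul_self_dvd [Fintype σ] [DecidableEq σ] {F q : (MvPolynomial σ ℂ)[X]}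
    (hF0 : F ≠ 0) (hF : ∀ i, (shiftHom i F).natDegree ≤ 1) (hq : q * q ∣ F) (z : ℂ)
    (u : σ → ℂ) : evalAt z u q = evalAt z 0 q := by
  -- The degree of `q` in each shift counts twice towards a total of at most one.
  have hdeg : ∀ i, (shiftHom i q).natDegree = 0 := by
    intro i
    obtain ⟨r, rfl⟩ := hq
    have hq0 : q ≠ 0 := by rintro rfl; simp at hF0
    have hr0 : r ≠ 0 := by rintro rfl; simp at hF0
    have h := hF i
    rw [map_mul, map_mul, natDegree_mul (mul_ne_zero (shiftHom_ne_zero i hq0)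
      (shiftHom_ne_zero i hq0)) (shiftHom_ne_zero i hr0), natDegree_mul (shiftHom_ne_zero i hq0)
      (shiftHom_ne_zero i hq0)] at h
    omega
  have key : ∀ s : Finset σ, evalAt z (∑ i ∈ s, Pi.single i (u i)) q = evalAt z 0 q := by
    intro s
    induction s using Finset.induction_on with
    | empty => simp
    | insert i s hi ih => rw [Finset.sum_insert hi, add_comm, evalAt_add_single (hdeg i), ih]
  have := key Finset.univ
  rwa [Finset.univ_sum_single] at this

/-- Splitting off the factor of a family that does not depend on the parameters. -/
theorem exists_eq_map_mul (m : ℕ) : ∀ F : (MvPolynomial σ ℂ)[X], F ≠ 0 → F.natDegree ≤ m →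
    ∃ (c : ℂ[X]) (g : (MvPolynomial σ ℂ)[X]), F = c.map MvPolynomial.C * g ∧
      ∀ z, ∃ u, evalAt z u g ≠ 0 := by
  induction m with
  | zero =>
    intro F hF0 hF
    refine ⟨1, F, by simp, fun z => ?_⟩
    by_contra! h
    refine hF0 (eq_zero_of_evalAt fun w u => ?_)
    have := h u
    rw [eq_C_of_natDegree_le_zero hF, evalAt_C] at this ⊢
    exact this
  | succ m ih =>
    intro F hF0 hF
    by_cases hall : ∀ z, ∃ u, evalAt z u F ≠ 0
    · exact ⟨1, F, by simp, hall⟩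
    push Not at hall
    obtain ⟨z, hz⟩ := hall
    have hroot : F.IsRoot (MvPolynomial.C z) := by
      refine MvPolynomial.funext fun u => ?_
      rw [map_zero, ← hz u, evalAt_eq_eval_map, eval_map, ← eval₂_at_apply, MvPolynomial.eval_C]
    obtain ⟨F', rfl⟩ := dvd_iff_isRoot.mpr hroot
    have hF'0 : F' ≠ 0 := by rintro rfl; simp at hF0
    rw [natDegree_mul (X_sub_C_ne_zero _) hF'0, natDegree_X_sub_C] at hF
    obtain ⟨c, g, hcg, hg⟩ := ih F' hF'0 (by omega)
    exact ⟨(X - C z) * c, g, by rw [hcg]; simp [mul_assoc], hg⟩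

/-- A Bertini-type theorem: if a family of univariate polynomials has degree at most one in each
parameter, then its generic member has only simple roots outside of the base points. -/
theorem exists_ne_zero_forall_simple_root [Fintype σ] [DecidableEq σ] {F : (MvPolynomial σ ℂ)[X]}
    (hF0 : F ≠ 0) (hF : ∀ i, (shiftHom i F).natDegree ≤ 1) :
    ∃ P : MvPolynomial σ ℂ, P ≠ 0 ∧ ∀ u, MvPolynomial.eval u P ≠ 0 → ∀ z,
      evalAt z u F = 0 → evalAt z u (derivative F) = 0 → ∀ u', evalAt z u' F = 0 := by
  obtain ⟨c, g, hcg, hg⟩ := exists_eq_map_mul F.natDegree F hF0 le_rfl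
  obtain ⟨P, a, b, hP0, hP⟩ := exists_mul_add_mul_derivative_eq_C g (by
    intro q hq hqg
    have hind := evalAt_eq_of_mul_self_dvd hF0 hF
      (hqg.trans (hcg ▸ dvd_mul_left g (c.map MvPolynomial.C)))
    obtain ⟨r, hr⟩ := hqg
    -- As `q` is independent of the parameters, a zero of `q` would be a base point of `g`. Having
    -- no zeros, `q` is a nonzero constant.
    have hroot : ∀ z, evalAt z 0 q ≠ 0 := by
      intro z hz
      obtain ⟨u, hu⟩ := hg z
      rw [hr, map_mul, map_mul, hind z u, hz] at hu
      simp at hu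
    have hdeg : (q.map (MvPolynomial.eval (0 : σ → ℂ))).degree = 0 := by
      by_contra hne
      obtain ⟨z, hz⟩ := IsAlgClosed.exists_root _ hne
      exact hroot z (by rw [evalAt_eq_eval_map]; exact hz)
    have hq1 : q = C (MvPolynomial.C (evalAt 0 0 q)) := by
      refine sub_eq_zero.mp (eq_zero_of_evalAt fun z u => ?_)
      rw [map_sub, evalAt_C, MvPolynomial.eval_C, hind z u, evalAt_eq_eval_map,
        evalAt_eq_eval_map, eq_C_of_degree_le_zero hdeg.le]
      simp
    rw [hq1]
    exact ((isUnit_iff_ne_zero.mpr (hroot 0)).map MvPolynomial.C).map C)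
  refine ⟨P, hP0, fun u hu z h0 h1 u' => ?_⟩
  rw [hcg, map_mul, evalAt_map_C] at h0 ⊢
  by_cases hc : c.eval z = 0
  · rw [hc, zero_mul]
  exfalso
  have hg0 := (mul_eq_zero.mp h0).resolve_left hc
  rw [hcg, derivative_mul, map_add, map_mul, map_mul, hg0, mul_zero, zero_add,
    evalAt_map_C] at h1
  have hg1 := (mul_eq_zero.mp h1).resolve_left hc
  have := congrArg (evalAt z u) hP
  rw [map_add, map_mul, map_mul, hg0, hg1, evalAt_C] at this
  exact hu (by simpa using this.symm)

end

/-! ### The determinant of the bordered pencil as a polynomial in the entries of the border -/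

section

variable {n k : ℕ}

/-- The determinant of a matrix bordered by indeterminates. -/
def borderedPoly (k : ℕ) (M : Matrix (Fin n) (Fin n) ℂ) :
    MvPolynomial ((Fin n × Fin k) ⊕ (Fin k × Fin n)) ℂ :=
  (bordered (M.map MvPolynomial.C) (Matrix.of fun i j => MvPolynomial.X (Sum.inl (i, j)))
    (Matrix.of fun i j => MvPolynomial.X (Sum.inr (i, j)))).det

/-- The pencil `A - X B` bordered by indeterminates. -/
def borderedPencil (k : ℕ) (A B : Matrix (Fin n) (Fin n) ℂ) :
    Matrix (Fin n ⊕ Fin k) (Fin n ⊕ Fin k)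
      (MvPolynomial ((Fin n × Fin k) ⊕ (Fin k × Fin n)) ℂ)[X] :=
  bordered (Matrix.of fun i j => C (MvPolynomial.C (A i j)) - X * C (MvPolynomial.C (B i j)))
    (Matrix.of fun i j => C (MvPolynomial.X (Sum.inl (i, j))))
    (Matrix.of fun i j => C (MvPolynomial.X (Sum.inr (i, j))))

theorem eval_borderedPoly (M : Matrix (Fin n) (Fin n) ℂ) (U : Matrix (Fin n) (Fin k) ℂ)
    (W : Matrix (Fin k) (Fin n) ℂ) :
    MvPolynomial.eval (entries U W) (borderedPoly k M) = (bordered M U W).det := by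
  rw [borderedPoly, RingHom.map_det]
  congr 1
  ext (i | i) (j | j) <;> simp [bordered, entries]

theorem evalAt_det_borderedPencil (A B : Matrix (Fin n) (Fin n) ℂ) (U : Matrix (Fin n) (Fin k) ℂ)
    (W : Matrix (Fin k) (Fin n) ℂ) (z : ℂ) :
    evalAt z (entries U W) (borderedPencil k A B).det = (bordered (A - z • B) U W).det := by
  rw [RingHom.map_det]
  congr 1
  ext (i | i) (j | j) <;> (simp [borderedPencil, bordered, entries]; try ring)

theorem borderedPoly_ne_zero {M : Matrix (Fin n) (Fin n) ℂ} (hM : M.rank + k = n) :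
    borderedPoly k M ≠ 0 := by
  obtain ⟨U, W, h⟩ := exists_det_bordered_ne_zero M hM
  intro h0
  rw [← eval_borderedPoly, h0, map_zero] at h
  exact h rfl

theorem det_borderedPencil_ne_zero {A B : Matrix (Fin n) (Fin n) ℂ} (hAB : nrank A B + k = n) :
    (borderedPencil k A B).det ≠ 0 := by
  obtain ⟨z, hz⟩ := exists_rank_eq_nrank A B
  obtain ⟨U, W, h⟩ := exists_det_bordered_ne_zero (k := k) (A - z • B) (by rw [hz, hAB])
  intro h0
  rw [← evalAt_det_borderedPencil, h0, map_zero] at h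
  exact h rfl

theorem natDegree_det_updateRow_le {ι R : Type*} [Fintype ι] [DecidableEq ι] [CommRing R]
    (G : Matrix ι ι R) (p q : ι) :
    ((G.map C).updateRow p ((G.map C) p + (X : R[X]) • Pi.single q 1)).det.natDegree ≤ 1 := by
  have h1 : (G.map C).det = C G.det := (RingHom.map_det (C : R →+* R[X]) G).symm
  have h2 : ((G.map C).updateRow p (Pi.single q 1)).det =
      C (G.updateRow p (Pi.single q 1)).det := by
    rw [RingHom.map_det]
    congr 1
    ext1 i j
    by_cases hi : i = p
    · subst hi
      by_cases hj : j = q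
      · subst hj; simp
      · simp [hj]
    · simp [Matrix.updateRow_ne hi]
  rw [Matrix.det_updateRow_add, Matrix.det_updateRow_smul, Matrix.updateRow_eq_self, h1, h2]
  compute_degree

/-- Each indeterminate occupies a single position, so shifting it adds a multiple of a unit vector
to one row. -/
theorem natDegree_shiftHom_det_borderedPencil_le (A B : Matrix (Fin n) (Fin n) ℂ)
    (i : (Fin n × Fin k) ⊕ (Fin k × Fin n)) :
    (shiftHom i (borderedPencil k A B).det).natDegree ≤ 1 := by
  have hdet : shiftHom i (borderedPencil k A B).det =
      ((borderedPencil k A B).map (shiftHom i)).det :=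
    RingHom.map_det (R := (MvPolynomial ((Fin n × Fin k) ⊕ (Fin k × Fin n)) ℂ)[X])
      (S := (MvPolynomial ((Fin n × Fin k) ⊕ (Fin k × Fin n)) ℂ)[X][X]) (shiftHom i) _
  rw [hdet]
  clear hdet
  rcases i with ⟨a, b⟩ | ⟨a, b⟩
  · suffices h : (borderedPencil k A B).map (shiftHom (Sum.inl (a, b))) =
        ((borderedPencil k A B).map C).updateRow (Sum.inl a)
          (((borderedPencil k A B).map C) (Sum.inl a) + X • Pi.single (Sum.inr b) 1) by
      rw [h]
      exact natDegree_det_updateRow_le _ _ _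
    ext1 (r | r) (s | s)
    · by_cases h : r = a
      · subst h; simp [borderedPencil, bordered]
      · simp [borderedPencil, bordered, Matrix.updateRow_apply, h]
    · by_cases h : r = a
      · subst h
        by_cases h' : s = b
        · subst h'; simp [borderedPencil, bordered]
        · simp [borderedPencil, bordered, h']
      · simp [borderedPencil, bordered, Matrix.updateRow_apply, h]
    · simp [borderedPencil, bordered, Matrix.updateRow_apply]
    · simp [borderedPencil, bordered, Matrix.updateRow_apply]
  · suffices h : (borderedPencil k A B).map (shiftHom (Sum.inr (a, b))) =
        ((borderedPencil k A B).map C).updateRow (Sum.inr a)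
          (((borderedPencil k A B).map C) (Sum.inr a) + X • Pi.single (Sum.inl b) 1) by
      rw [h]
      exact natDegree_det_updateRow_le _ _ _
    ext1 (r | r) (s | s)
    · simp [borderedPencil, bordered, Matrix.updateRow_apply]
    · simp [borderedPencil, bordered, Matrix.updateRow_apply]
    · by_cases h : r = a
      · subst h
        by_cases h' : s = b
        · subst h'; simp [borderedPencil, bordered]
        · simp [borderedPencil, bordered, h']
      · simp [borderedPencil, bordered, Matrix.updateRow_apply, h]
    · by_cases h : r = a
      · subst h; simp [borderedPencil, bordered]
      · simp [borderedPencil, bordered, Matrix.updateRow_apply, h]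

/-- For a generic border, every zero of the determinant of the bordered pencil that is not an
eigenvalue of the pencil is simple. -/
theorem exists_ne_zero_forall_trace_ne_zero {A B : Matrix (Fin n) (Fin n) ℂ}
    (hAB : nrank A B + k = n) :
    ∃ P : MvPolynomial ((Fin n × Fin k) ⊕ (Fin k × Fin n)) ℂ, P ≠ 0 ∧
      ∀ (U : Matrix (Fin n) (Fin k) ℂ) (W : Matrix (Fin k) (Fin n) ℂ),
        MvPolynomial.eval (entries U W) P ≠ 0 → ∀ z : ℂ, (A - z • B).rank + k = n →
          (bordered (A - z • B) U W).det = 0 →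
          ((bordered (A - z • B) U W).adjugate * bordered B 0 0).trace ≠ 0 := by
  obtain ⟨P, hP0, hP⟩ := exists_ne_zero_forall_simple_root (det_borderedPencil_ne_zero hAB)
    (natDegree_shiftHom_det_borderedPencil_le A B)
  refine ⟨P, hP0, fun U W hu z hz h0 htr => ?_⟩
  have hd1 : HasDerivAt (fun t : ℂ => (bordered (A - t • B) U W).det)
      ((bordered (A - z • B) U W).adjugate * -bordered B 0 0).trace z := by
    refine hasDerivAt_det fun i j => ?_
    rcases i with i | i <;> rcases j with j | j
    · simpa [bordered] using ((hasDerivAt_id z).mul_const (B i j)).const_sub (A i j)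
    all_goals simpa [bordered] using hasDerivAt_const z _
  have hd2 : HasDerivAt (fun t : ℂ => (bordered (A - t • B) U W).det)
      (evalAt z (entries U W) (derivative (borderedPencil k A B).det)) z := by
    have h := ((borderedPencil k A B).det.map (MvPolynomial.eval (entries U W))).hasDerivAt z
    simp only [← evalAt_det_borderedPencil, evalAt_eq_eval_map, ← derivative_map]
    exact h
  have h1 := hd2.unique hd1
  rw [Matrix.mul_neg, Matrix.trace_neg, htr, neg_zero] at h1
  -- Some border is nonsingular at `z`, so `z` is not a base point of the family.
  obtain ⟨U', W', h'⟩ := exists_det_bordered_ne_zero (k := k) (A - z • B) hz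
  have := hP (entries U W) hu z (by rw [evalAt_det_borderedPencil, h0]) h1 (entries U' W')
  rw [evalAt_det_borderedPencil] at this
  exact h' this

end

/-! ### Eigenvectors of the perturbed pencil -/

section

variable {n k : ℕ}

/-- The scaling law of `SLaw` in terms of row vectors instead of conjugated column vectors. -/
def RowLaw (At Bt : ℂ → Matrix (Fin n) (Fin n) ℂ) (lam : ℂ) (x y : ℂ → Fin n → ℂ) (s : ℂ) :
    Prop :=
  ∀ τ : ℂ, τ ≠ 0 →
    x τ ≠ 0 ∧ (At τ - lam • Bt τ) *ᵥ x τ = 0 ∧ y τ ≠ 0 ∧ y τ ᵥ* (At τ - lam • Bt τ) = 0 ∧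
    (∀ x', (At τ - lam • Bt τ) *ᵥ x' = 0 → ∃ r : ℂ, x' = r • x τ) ∧
    (∀ y', y' ᵥ* (At τ - lam • Bt τ) = 0 → ∃ r : ℂ, y' = r • y τ) ∧
    y τ ⬝ᵥ (Bt τ *ᵥ x τ) = τ * s

theorem euclNorm_smul (r : ℂ) (x : Fin n → ℂ) : euclNorm (r • x) = ‖r‖ * euclNorm x := by
  rw [euclNorm, WithLp.toLp_smul, norm_smul, euclNorm]

theorem euclNorm_star (x : Fin n → ℂ) : euclNorm (star x) = euclNorm x := by
  simp [euclNorm, EuclideanSpace.norm_eq]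

theorem euclNorm_pos {x : Fin n → ℂ} (hx : x ≠ 0) : 0 < euclNorm x := by
  rw [euclNorm, norm_pos_iff]
  simpa using hx

theorem exists_smul_euclNorm_eq_one {x : Fin n → ℂ} (hx : x ≠ 0) :
    ∃ r : ℂ, r ≠ 0 ∧ euclNorm (r • x) = 1 := by
  have h := euclNorm_pos hx
  refine ⟨((euclNorm x)⁻¹ : ℝ), by exact_mod_cast inv_ne_zero h.ne', ?_⟩
  rw [euclNorm_smul, Complex.norm_real, norm_inv, Real.norm_of_nonneg h.le, inv_mul_cancel₀ h.ne']

section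

variable {At Bt : ℂ → Matrix (Fin n) (Fin n) ℂ} {lam : ℂ} {x y : ℂ → Fin n → ℂ} {s : ℂ}

theorem RowLaw.smul (h : RowLaw At Bt lam x y s) {α β : ℂ} (hα : α ≠ 0) (hβ : β ≠ 0) :
    RowLaw At Bt lam (fun τ => α • x τ) (fun τ => β • y τ) (α * β * s) := by
  intro τ hτ
  obtain ⟨h1, h2, h3, h4, h5, h6, h7⟩ := h τ hτ
  refine ⟨smul_ne_zero hα h1, by rw [Matrix.mulVec_smul, h2, smul_zero], smul_ne_zero hβ h3,
    by rw [Matrix.smul_vecMul, h4, smul_zero], fun x' hx' => ?_, fun y' hy' => ?_, ?_⟩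
  · obtain ⟨r, hr⟩ := h5 x' hx'
    exact ⟨r * α⁻¹, by rw [smul_smul, inv_mul_cancel_right₀ hα, hr]⟩
  · obtain ⟨r, hr⟩ := h6 y' hy'
    exact ⟨r * β⁻¹, by rw [smul_smul, inv_mul_cancel_right₀ hβ, hr]⟩
  · rw [Matrix.mulVec_smul, dotProduct_smul, smul_dotProduct, h7]
    simp only [smul_eq_mul]
    ring

theorem RowLaw.of_transpose (h : RowLaw (fun τ => (At τ)ᵀ) (fun τ => (Bt τ)ᵀ) lam x y s) :
    RowLaw At Bt lam y x s := by
  intro τ hτ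
  obtain ⟨h1, h2, h3, h4, h5, h6, h7⟩ := h τ hτ
  simp only [← Matrix.transpose_smul, ← Matrix.transpose_sub, Matrix.mulVec_transpose,
    Matrix.vecMul_transpose] at h2 h4 h5 h6 h7
  refine ⟨h3, h4, h1, h2, h6, h5, ?_⟩
  rw [← h7, Matrix.dotProduct_mulVec, dotProduct_comm]

theorem RowLaw.sLaw (h : RowLaw At Bt lam x y s) :
    SLaw At Bt lam x (fun τ => star (y τ)) ‖s‖ := by
  intro τ hτ
  obtain ⟨h1, h2, h3, h4, h5, h6, h7⟩ := h τ hτ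
  have h6' : ∀ y', IsLeftEigenvector (At τ) (Bt τ) lam y' → ∃ r : ℂ, y' = r • star (y τ) := by
    intro y' hy'
    obtain ⟨r, hr⟩ := h6 _ hy'.2
    exact ⟨star r, by rw [← star_smul, ← hr, star_star]⟩
  refine ⟨⟨h1, h2⟩, ⟨star_ne_zero.mpr h3, by rwa [star_star]⟩, fun x' hx' => h5 x' hx'.2, h6',
    ?_, ?_⟩
  · rw [sValue, star_star, h7, norm_mul, mul_comm]
  · intro x' y' hx' hx1 hy' hy1
    obtain ⟨r, rfl⟩ := h5 x' hx'.2
    obtain ⟨q, rfl⟩ := h6' y' hy'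
    rw [euclNorm_smul] at hx1 hy1
    have hx := euclNorm_pos h1
    have hy := euclNorm_pos (star_ne_zero.mpr h3)
    have hs : sValue (Bt τ) (r • x τ) (q • star (y τ)) = star q * r * (τ * s) := by
      rw [sValue, star_smul, star_star, Matrix.mulVec_smul, dotProduct_smul, smul_dotProduct, h7]
      simp only [smul_eq_mul]
      ring
    rw [hs, eq_div_iff (mul_pos hx hy).ne', norm_mul, norm_mul, norm_mul, norm_star]
    calc ‖q‖ * ‖r‖ * (‖τ‖ * ‖s‖) * (euclNorm (x τ) * euclNorm (star (y τ)))
        = (‖r‖ * euclNorm (x τ)) * (‖q‖ * euclNorm (star (y τ))) * (‖s‖ * ‖τ‖) := by ring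
      _ = ‖s‖ * ‖τ‖ := by rw [hx1, hy1]; ring

end

/-- The perturbation `C + τ U diag(d) W`. -/
def updated (C : Matrix (Fin n) (Fin n) ℂ) (U : Matrix (Fin n) (Fin k) ℂ)
    (W : Matrix (Fin k) (Fin n) ℂ) (d : Fin k → ℂ) (τ : ℂ) : Matrix (Fin n) (Fin n) ℂ :=
  C + τ • (U * Matrix.diagonal d * W)

variable {A B : Matrix (Fin n) (Fin n) ℂ} {U : Matrix (Fin n) (Fin k) ℂ}
  {W : Matrix (Fin k) (Fin n) ℂ} {a b : Fin k → ℂ} {lam : ℂ}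

theorem updated_transpose (C : Matrix (Fin n) (Fin n) ℂ) (d : Fin k → ℂ) (τ : ℂ) :
    (updated C U W d τ)ᵀ = updated Cᵀ Wᵀ Uᵀ d τ := by
  simp [updated, Matrix.transpose_mul, Matrix.mul_assoc]

theorem updated_sub_smul_updated (A B : Matrix (Fin n) (Fin n) ℂ) (a b : Fin k → ℂ) (lam τ : ℂ) :
    updated A U W a τ - lam • updated B U W b τ =
      updated (A - lam • B) U W (a - lam • b) τ := by
  have : Matrix.diagonal (a - lam • b) = Matrix.diagonal a - lam • Matrix.diagonal b := by
    rw [← Matrix.diagonal_smul, Matrix.diagonal_sub]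
    rfl
  rw [updated, updated, updated, this, Matrix.mul_sub, Matrix.sub_mul, Matrix.mul_smul,
    Matrix.smul_mul, smul_sub, smul_add, smul_comm lam τ]
  abel

theorem updated_mulVec (C : Matrix (Fin n) (Fin n) ℂ) (d : Fin k → ℂ) (τ : ℂ) (x : Fin n → ℂ) :
    updated C U W d τ *ᵥ x = C *ᵥ x + U *ᵥ (τ • (d * (W *ᵥ x))) := by
  have : Matrix.diagonal d *ᵥ (W *ᵥ x) = d * (W *ᵥ x) := by
    ext i; simp [Matrix.mulVec_diagonal]
  rw [updated, Matrix.add_mulVec, Matrix.smul_mulVec, ← Matrix.mulVec_mulVec,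
    ← Matrix.mulVec_mulVec, this, Matrix.mulVec_smul]

theorem vecMul_updated (C : Matrix (Fin n) (Fin n) ℂ) (d : Fin k → ℂ) (τ : ℂ) (y : Fin n → ℂ) :
    y ᵥ* updated C U W d τ = y ᵥ* C + (τ • (d * (y ᵥ* U))) ᵥ* W := by
  rw [← Matrix.mulVec_transpose, updated_transpose, updated_mulVec]
  simp only [Matrix.mulVec_transpose]

/-- At a simple zero of the bordered determinant with a right null vector annihilated by `W`, that
vector is the right eigenvector for all `τ`, and the left eigenvector is affine in `τ`. -/
theorem exists_rowLaw_of_right (hAB : nrank A B + k = n) (hM : (A - lam • B).rank + k = n)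
    (hd : ∀ i, a i - lam * b i ≠ 0)
    (htr : ((bordered (A - lam • B) U W).adjugate * bordered B 0 0).trace ≠ 0)
    {x : Fin n → ℂ} (hx0 : x ≠ 0) (hx : (A - lam • B) *ᵥ x = 0) (hWx : W *ᵥ x = 0) :
    ∃ (ω ζ : Fin n → ℂ) (s : ℂ), ω ≠ 0 ∧ s ≠ 0 ∧
      RowLaw (updated A U W a) (updated B U W b) lam (fun _ => x) (fun τ => ω + τ • ζ) s := by
  have hxG0 : (Sum.elim x 0 : Fin n ⊕ Fin k → ℂ) ≠ 0 := fun h => hx0 (sumElim_eq_zero.mp h).1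
  have hxG : bordered (A - lam • B) U W *ᵥ Sum.elim x 0 = 0 := by
    rw [bordered_mulVec, sumElim_eq_zero]
    simp [hx, hWx]
  have hdet : (bordered (A - lam • B) U W).det = 0 :=
    Matrix.exists_mulVec_eq_zero_iff.mp ⟨_, hxG0, hxG⟩
  obtain ⟨l, hl0, hl⟩ := Matrix.exists_vecMul_eq_zero_iff.mpr hdet
  obtain ⟨ζ, q, rfl⟩ : ∃ ζ q, l = Sum.elim ζ q := ⟨l ∘ Sum.inl, l ∘ Sum.inr, by simp⟩
  obtain ⟨hright, hleft, hpair⟩ :=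
    kernels_of_trace_adjugate_mul_ne_zero hdet htr hxG0 hxG hl0 hl
  rw [bordered_mulVec, sumElim_dotProduct_sumElim] at hpair
  simp only [Matrix.zero_mulVec, add_zero, dotProduct_zero] at hpair
  rw [vecMul_bordered, sumElim_eq_zero] at hl
  obtain ⟨hζ, hζU⟩ := hl
  have hB : ∀ y, y ᵥ* (A - lam • B) = 0 → y ⬝ᵥ (B *ᵥ x) = 0 := fun y hy =>
    dotProduct_mulVec_eq_zero hAB hM hx hy
  -- Such a `y` would be a multiple of `ζ`; since `B` pairs it trivially with `x` but pairs `ζ`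
  -- nontrivially, the multiple is zero.
  have hinj : ∀ y, y ᵥ* (A - lam • B) = 0 → y ᵥ* U = 0 → y = 0 := by
    intro y h1 h2
    obtain ⟨α, hα⟩ := hleft (Sum.elim y 0) (by
      rw [vecMul_bordered, sumElim_eq_zero]
      simp [h1, h2])
    have h3 : y = α • ζ := funext fun i => by simpa using congrFun hα (Sum.inl i)
    have h4 := hB y h1
    rw [h3, smul_dotProduct, smul_eq_mul] at h4
    rw [h3, (mul_eq_zero.mp h4).resolve_right hpair, zero_smul]
  have hq : q ≠ 0 := by
    rintro rfl
    exact hpair (hB ζ (by simpa using hζ))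
  have hdne : ∀ i, (a - lam • b) i ≠ 0 := fun i => by simpa using hd i
  generalize hdd : a - lam • b = d at hdne
  obtain ⟨ω, hω, hωU⟩ := exists_vecMul_eq_zero_vecMul_eq hM.le hinj (d⁻¹ * q)
  have hωq : d * (ω ᵥ* U) = q := by
    rw [hωU]
    ext i
    simp [mul_inv_cancel_left₀ (hdne i)]
  have hω0 : ω ≠ 0 := by
    rintro rfl
    exact hq (by rw [← hωq]; simp)
  refine ⟨ω, ζ, ζ ⬝ᵥ (B *ᵥ x), hω0, hpair, fun τ hτ => ?_⟩
  rw [updated_sub_smul_updated, hdd]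
  have hdcancel : ∀ v : Fin k → ℂ, d * v = 0 → v = 0 := fun v hv => funext fun i =>
    (mul_eq_zero.mp (congrFun hv i)).resolve_left (hdne i)
  refine ⟨hx0, ?_, ?_, ?_, fun x' hx' => ?_, fun y' hy' => ?_, ?_⟩
  · rw [updated_mulVec, hx, hWx]; simp
  · intro h0
    have h1 := congrArg (fun v => v ᵥ* U) h0
    simp only [Matrix.add_vecMul, Matrix.smul_vecMul, hζU, smul_zero, add_zero,
      Matrix.zero_vecMul] at h1
    exact hω0 (hinj ω hω h1)
  · rw [vecMul_updated, Matrix.add_vecMul, Matrix.add_vecMul, Matrix.smul_vecMul,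
      Matrix.smul_vecMul, Matrix.smul_vecMul, hω, hζU, smul_zero, add_zero, hωq, zero_add,
      ← smul_add, hζ, smul_zero]
  · rw [updated_mulVec] at hx'
    obtain ⟨h1, h2⟩ := eq_zero_of_mulVec_add_mulVec_eq_zero hM.le hinj hx'
    have h3 := hdcancel _ ((smul_eq_zero.mp h2).resolve_left hτ)
    obtain ⟨α, hα⟩ := hright (Sum.elim x' 0) (by
      rw [bordered_mulVec, sumElim_eq_zero]
      simp [h1, h3])
    exact ⟨α, funext fun i => by simpa using congrFun hα (Sum.inl i)⟩
  · rw [vecMul_updated] at hy'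
    -- Subtracting a null vector with the same product with `U` turns `y'` into a left null vector
    -- of the bordered matrix, hence a multiple of `(ζ, q)`.
    obtain ⟨w, hw, hwU⟩ := exists_vecMul_eq_zero_vecMul_eq hM.le hinj (y' ᵥ* U)
    obtain ⟨α, hα⟩ := hleft (Sum.elim (y' - w) (τ • (d * (y' ᵥ* U)))) (by
      rw [vecMul_bordered, sumElim_eq_zero, Matrix.sub_vecMul, Matrix.sub_vecMul, hw, hwU,
        sub_zero, sub_self]
      exact ⟨hy', rfl⟩)
    have h1 : y' - w = α • ζ := funext fun i => by simpa using congrFun hα (Sum.inl i)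
    have h2 : τ • (d * (y' ᵥ* U)) = α • q := funext fun i => by
      simpa using congrFun hα (Sum.inr i)
    have h3 : w - (α / τ) • ω = 0 := by
      refine hinj _ ?_ ?_
      · rw [Matrix.sub_vecMul, hw, Matrix.smul_vecMul, hω, smul_zero, sub_zero]
      · refine hdcancel _ ?_
        rw [Matrix.sub_vecMul, hwU, Matrix.smul_vecMul, mul_sub, mul_smul_comm, hωq,
          div_eq_inv_mul, mul_smul, ← h2, smul_smul, inv_mul_cancel₀ hτ, one_smul, sub_self]
    refine ⟨α / τ, ?_⟩
    rw [smul_add, smul_smul, div_mul_cancel₀ _ hτ, ← h1, ← sub_eq_zero.mp h3]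
    abel
  · rw [updated_mulVec, hWx]
    simp only [mul_zero, smul_zero, Matrix.mulVec_zero, add_zero]
    rw [add_dotProduct, hB ω hω, smul_dotProduct, zero_add, smul_eq_mul]

theorem nrank_transpose (A B : Matrix (Fin n) (Fin n) ℂ) : nrank Aᵀ Bᵀ = nrank A B := by
  simp only [nrank, ← Matrix.transpose_smul, ← Matrix.transpose_sub, Matrix.rank_transpose]

theorem exists_rowLaw_of_left (hAB : nrank A B + k = n) (hM : (A - lam • B).rank + k = n)
    (hd : ∀ i, a i - lam * b i ≠ 0)
    (htr : ((bordered (A - lam • B) U W).adjugate * bordered B 0 0).trace ≠ 0)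
    {y : Fin n → ℂ} (hy0 : y ≠ 0) (hy : y ᵥ* (A - lam • B) = 0) (hyU : y ᵥ* U = 0) :
    ∃ (ω ζ : Fin n → ℂ) (s : ℂ), ω ≠ 0 ∧ s ≠ 0 ∧
      RowLaw (updated A U W a) (updated B U W b) lam (fun τ => ω + τ • ζ) (fun _ => y) s := by
  obtain ⟨ω, ζ, s, hω, hs, h⟩ := exists_rowLaw_of_right (A := Aᵀ) (B := Bᵀ) (U := Wᵀ) (W := Uᵀ)
    (a := a) (b := b) (lam := lam) (x := y) (k := k) (by rwa [nrank_transpose])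
    (by rwa [← Matrix.transpose_smul, ← Matrix.transpose_sub, Matrix.rank_transpose]) hd (by
      have h1 : bordered Bᵀ 0 0 = (bordered B (0 : Matrix (Fin n) (Fin k) ℂ) 0)ᵀ := by
        rw [bordered_transpose]; simp
      rw [← Matrix.transpose_smul, ← Matrix.transpose_sub, ← bordered_transpose, h1,
        ← Matrix.adjugate_transpose, Matrix.trace_mul_comm, ← Matrix.transpose_mul,
        Matrix.trace_transpose]
      exact htr) hy0
    (by rwa [← Matrix.transpose_smul, ← Matrix.transpose_sub, Matrix.mulVec_transpose])
    (by rwa [Matrix.mulVec_transpose])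
  refine ⟨ω, ζ, s, hω, hs, RowLaw.of_transpose ?_⟩
  simp only [updated_transpose]
  exact h

/-- At a prescribed eigenvalue both eigenvectors are null vectors of the original pencil. -/
theorem exists_rowLaw_of_prescribed (hAB : nrank A B + k = n) (hM : (A - lam • B).rank + k = n)
    (hdet : (bordered (A - lam • B) U W).det ≠ 0) {i : Fin k} (hi : a i - lam * b i = 0)
    (hne : ∀ j, j ≠ i → a j - lam * b j ≠ 0) (hb : b i ≠ 0) :
    ∃ (x y : Fin n → ℂ) (s : ℂ), x ≠ 0 ∧ y ≠ 0 ∧ s ≠ 0 ∧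
      RowLaw (updated A U W a) (updated B U W b) lam (fun _ => x) (fun _ => y) s := by
  have hr := eq_zero_of_mulVec_eq_zero_of_det_bordered hdet
  have hl := eq_zero_of_vecMul_eq_zero_of_det_bordered hdet
  obtain ⟨x, hx, hWx⟩ := exists_mem_ker_mulVec_eq hM.le hr (Pi.single i 1)
  obtain ⟨y, hy, hyU⟩ := exists_vecMul_eq_zero_vecMul_eq hM.le hl (Pi.single i 1)
  have hsingle : (Pi.single i 1 : Fin k → ℂ) ≠ 0 := by simp
  have hx0 : x ≠ 0 := by
    rintro rfl
    exact hsingle (by rw [← hWx, Matrix.mulVec_zero])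
  have hy0 : y ≠ 0 := by
    rintro rfl
    exact hsingle (by rw [← hyU, Matrix.zero_vecMul])
  have hB : y ⬝ᵥ (B *ᵥ x) = 0 := dotProduct_mulVec_eq_zero hAB hM hx hy
  have hdi : (a - lam • b) * Pi.single i 1 = 0 := by
    ext j
    by_cases hj : j = i
    · subst hj; simpa using hi
    · simp [hj]
  have hspan : ∀ v : Fin k → ℂ, (a - lam • b) * v = 0 → v = v i • Pi.single i 1 := by
    intro v hv
    ext j
    by_cases hj : j = i
    · subst hj; simp
    · have := (mul_eq_zero.mp (congrFun hv j)).resolve_left (by simpa using hne j hj)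
      simp [hj, this]
  refine ⟨x, y, b i, hx0, hy0, hb, fun τ hτ => ?_⟩
  rw [updated_sub_smul_updated]
  refine ⟨hx0, ?_, hy0, ?_, fun x' hx' => ?_, fun y' hy' => ?_, ?_⟩
  · rw [updated_mulVec, hx, hWx, hdi]; simp
  · rw [vecMul_updated, hy, hyU, hdi]; simp
  · rw [updated_mulVec] at hx'
    obtain ⟨h1, h2⟩ := eq_zero_of_mulVec_add_mulVec_eq_zero hM.le hl hx'
    have h3 := hspan _ ((smul_eq_zero.mp h2).resolve_left hτ)
    refine ⟨(W *ᵥ x') i, sub_eq_zero.mp (hr _ ?_ ?_)⟩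
    · rw [Matrix.mulVec_sub, Matrix.mulVec_smul, h1, hx, smul_zero, sub_zero]
    · rw [Matrix.mulVec_sub, Matrix.mulVec_smul, hWx, ← h3, sub_self]
  · rw [vecMul_updated] at hy'
    have hrT : ∀ z, z ᵥ* (A - lam • B)ᵀ = 0 → z ᵥ* Wᵀ = 0 → z = 0 := by
      simpa only [Matrix.vecMul_transpose] using hr
    obtain ⟨h1, h2⟩ := eq_zero_of_mulVec_add_mulVec_eq_zero (C := (A - lam • B)ᵀ) (U := Wᵀ)
      (x := y') (w := τ • ((a - lam • b) * (y' ᵥ* U))) (by rw [Matrix.rank_transpose, hM]) hrT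
      (by simpa only [Matrix.mulVec_transpose] using hy')
    rw [Matrix.mulVec_transpose] at h1
    have h3 := hspan _ ((smul_eq_zero.mp h2).resolve_left hτ)
    refine ⟨(y' ᵥ* U) i, sub_eq_zero.mp (hl _ ?_ ?_)⟩
    · rw [Matrix.sub_vecMul, Matrix.smul_vecMul, h1, hy, smul_zero, sub_zero]
    · rw [Matrix.sub_vecMul, Matrix.smul_vecMul, hyU, ← h3, sub_self]
  · rw [updated_mulVec, dotProduct_add, hB, zero_add, Matrix.dotProduct_mulVec, hyU, hWx]
    simp

/-- A singular member of the updated pencil comes from a null vector annihilated by the update. -/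
theorem exists_null_vector_of_det_updated_eq_zero {M : Matrix (Fin n) (Fin n) ℂ}
    (hM : M.rank + k ≤ n) {d : Fin k → ℂ} (hd : ∀ i, d i ≠ 0) {τ : ℂ} (hτ : τ ≠ 0)
    (h : (updated M U W d τ).det = 0) :
    (∃ x, x ≠ 0 ∧ M *ᵥ x = 0 ∧ W *ᵥ x = 0) ∨ ∃ y, y ≠ 0 ∧ y ᵥ* M = 0 ∧ y ᵥ* U = 0 := by
  by_cases hl : ∀ y, y ᵥ* M = 0 → y ᵥ* U = 0 → y = 0
  · left
    obtain ⟨x, hx0, hx⟩ := Matrix.exists_mulVec_eq_zero_iff.mpr h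
    rw [updated_mulVec] at hx
    obtain ⟨h1, h2⟩ := eq_zero_of_mulVec_add_mulVec_eq_zero hM hl hx
    refine ⟨x, hx0, h1, funext fun i => ?_⟩
    exact (mul_eq_zero.mp (congrFun ((smul_eq_zero.mp h2).resolve_left hτ) i)).resolve_left (hd i)
  · right
    push Not at hl
    obtain ⟨y, h1, h2, h3⟩ := hl
    exact ⟨y, h3, h1, h2⟩

theorem det_bordered_eq_zero_of_null_vector {M : Matrix (Fin n) (Fin n) ℂ}
    (h : (∃ x, x ≠ 0 ∧ M *ᵥ x = 0 ∧ W *ᵥ x = 0) ∨ ∃ y, y ≠ 0 ∧ y ᵥ* M = 0 ∧ y ᵥ* U = 0) :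
    (bordered M U W).det = 0 := by
  by_contra hne
  rcases h with ⟨x, h0, h1, h2⟩ | ⟨y, h0, h1, h2⟩
  · exact h0 (eq_zero_of_mulVec_eq_zero_of_det_bordered hne x h1 h2)
  · exact h0 (eq_zero_of_vecMul_eq_zero_of_det_bordered hne y h1 h2)

theorem det_eq_zero_of_rank_lt {M : Matrix (Fin n) (Fin n) ℂ} (h : M.rank < n) : M.det = 0 := by
  by_contra hne
  have := Matrix.rank_of_isUnit M ((Matrix.isUnit_iff_isUnit_det M).mpr (isUnit_iff_ne_zero.mpr hne))
  rw [Fintype.card_fin] at this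
  omega

end

/-! ### Genericity and the main theorem -/

theorem generically_of_ne_zero {n k : ℕ}
    {Q : Matrix (Fin n) (Fin k) ℂ → Matrix (Fin n) (Fin k) ℂ → Prop}
    {P : MvPolynomial ((Fin n × Fin k) ⊕ (Fin k × Fin n)) ℂ} (hP : P ≠ 0)
    (h : ∀ U V, MvPolynomial.eval (entries U Vᴴ) P ≠ 0 → Q U V) : Generically Q := by
  refine ⟨{v | MvPolynomial.eval v P ≠ 0}, ⟨{v | MvPolynomial.eval v P = 0}, ⟨{P}, by simp⟩,
    fun huniv => hP (MvPolynomial.funext fun v => ?_), fun v hv => by simpa using hv⟩, h⟩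
  rw [map_zero]
  exact (Set.eq_univ_iff_forall.mp huniv) v

section

variable {n k : ℕ} {A B : Matrix (Fin n) (Fin n) ℂ} {a b : Fin k → ℂ}

theorem ne_zero_of_isRegular_diagonal
    (hD : IsRegular (Matrix.diagonal a) (Matrix.diagonal b)) {i : Fin k} (hb : b i = 0) :
    a i ≠ 0 := by
  obtain ⟨z, hz⟩ := hD
  rw [← Matrix.diagonal_smul, Matrix.diagonal_sub, Matrix.det_diagonal,
    Finset.prod_ne_zero_iff] at hz
  simpa [hb] using hz i (Finset.mem_univ i)

theorem gamma_eq_coe_of_sub_eq_zero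
    (hD : IsRegular (Matrix.diagonal a) (Matrix.diagonal b)) {i : Fin k} {z : ℂ}
    (h : a i - z * b i = 0) : gamma a b i = (z : OnePoint ℂ) := by
  by_cases hb : b i = 0
  · exact absurd (by simpa [hb] using h) (ne_zero_of_isRegular_diagonal hD hb)
  · rw [gamma, if_neg hb, sub_eq_zero.mp h, mul_div_cancel_right₀ _ hb]

theorem ne_zero_and_div_eq_of_gamma_eq_coe {i : Fin k} {z : ℂ}
    (h : gamma a b i = (z : OnePoint ℂ)) : b i ≠ 0 ∧ a i / b i = z := by
  rw [gamma] at h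
  split_ifs at h with hb
  · exact absurd h (OnePoint.infty_ne_coe z)
  · exact ⟨hb, OnePoint.coe_injective h⟩

theorem rank_add_eq_of_not_isEigenvalue (hAB : nrank A B + k = n) {z : ℂ}
    (h : ¬ IsEigenvalue A B (z : OnePoint ℂ)) : (A - z • B).rank + k = n := by
  have h1 := rank_le_nrank A B z
  have h2 : ¬ (A - z • B).rank < nrank A B := fun hlt => h (Or.inr ⟨z, rfl, hlt⟩)
  omega

theorem rank_add_eq_of_not_isEigenvalue_infty (hAB : nrank A B + k = n)
    (h : ¬ IsEigenvalue A B OnePoint.infty) : B.rank + k = n := by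
  have h1 := rank_right_le_nrank A B
  have h2 : ¬ B.rank < nrank A B := fun hlt => h (Or.inl ⟨rfl, hlt⟩)
  omega

variable {U V : Matrix (Fin n) (Fin k) ℂ}

theorem exists_sLaw_of_prescribed (hAB : nrank A B + k = n)
    (hD : IsRegular (Matrix.diagonal a) (Matrix.diagonal b))
    (hγ : ∀ i, ¬ IsEigenvalue A B (gamma a b i)) (hsimple : Function.Injective (gamma a b))
    {i : Fin k} {lam : ℂ} (hi : gamma a b i = (lam : OnePoint ℂ))
    (hdet : (bordered (A - lam • B) U Vᴴ).det ≠ 0) :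
    ∃ c : ℝ, 0 < c ∧ ∃ x y : Fin n → ℂ, euclNorm x = 1 ∧ euclNorm y = 1 ∧
      SLaw (perturbed A U V a) (perturbed B U V b) lam (fun _ => x) (fun _ => y) c := by
  obtain ⟨hb, hlam⟩ := ne_zero_and_div_eq_of_gamma_eq_coe hi
  have hM := rank_add_eq_of_not_isEigenvalue hAB (hi ▸ hγ i)
  obtain ⟨x, y, s, hx, hy, hs, h⟩ := exists_rowLaw_of_prescribed (a := a) hAB hM hdet (i := i)
    (by rw [← hlam, div_mul_cancel₀ _ hb, sub_self])
    (fun j hj h0 => hj (hsimple ((gamma_eq_coe_of_sub_eq_zero hD h0).trans hi.symm))) hb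
  obtain ⟨α, hα, hα1⟩ := exists_smul_euclNorm_eq_one hx
  obtain ⟨β, hβ, hβ1⟩ := exists_smul_euclNorm_eq_one hy
  exact ⟨_, norm_pos_iff.mpr (mul_ne_zero (mul_ne_zero hα hβ) hs), α • x, star (β • y), hα1,
    by rwa [euclNorm_star], (h.smul hα hβ).sLaw⟩

/-- Singularity at a single `τ` suffices for the law at all `τ`, as the null vector it produces does
not involve `τ`. -/
theorem exists_sLaw_of_simple (hAB : nrank A B + k = n) {lam : ℂ}
    (hM : (A - lam • B).rank + k = n) (hd : ∀ i, a i - lam * b i ≠ 0)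
    (htr : (bordered (A - lam • B) U Vᴴ).det = 0 →
      ((bordered (A - lam • B) U Vᴴ).adjugate * bordered B 0 0).trace ≠ 0)
    {τ : ℂ} (hτ : τ ≠ 0) (hdet : (perturbed A U V a τ - lam • perturbed B U V b τ).det = 0) :
    ∃ c : ℝ, 0 < c ∧
      ((∃ x w z : Fin n → ℂ, euclNorm x = 1 ∧ euclNorm w = 1 ∧ Vᴴ *ᵥ x = 0 ∧
          SLaw (perturbed A U V a) (perturbed B U V b) lam
            (fun _ => x) (fun τ => w + conj τ • z) c) ∨
        (∃ y w z : Fin n → ℂ, euclNorm y = 1 ∧ euclNorm w = 1 ∧ Uᴴ *ᵥ y = 0 ∧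
          SLaw (perturbed A U V a) (perturbed B U V b) lam
            (fun τ => w + τ • z) (fun _ => y) c)) := by
  have hupd := updated_sub_smul_updated (U := U) (W := Vᴴ) A B a b lam τ
  have hnull := exists_null_vector_of_det_updated_eq_zero (W := Vᴴ) (U := U) hM.le
    (d := a - lam • b) (fun i => by simpa using hd i) hτ (hupd ▸ hdet)
  have htr' := htr (det_bordered_eq_zero_of_null_vector hnull)
  rcases hnull with ⟨x, hx0, hx, hVx⟩ | ⟨y, hy0, hy, hyU⟩
  · obtain ⟨ω, ζ, s, hω, hs, h⟩ := exists_rowLaw_of_right hAB hM hd htr' hx0 hx hVx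
    obtain ⟨α, hα, hα1⟩ := exists_smul_euclNorm_eq_one hx0
    obtain ⟨β, hβ, hβ1⟩ := exists_smul_euclNorm_eq_one hω
    refine ⟨_, norm_pos_iff.mpr (mul_ne_zero (mul_ne_zero hα hβ) hs), Or.inl
      ⟨α • x, star (β • ω), star (β • ζ), hα1, by rwa [euclNorm_star],
        by rw [Matrix.mulVec_smul, hVx, smul_zero], ?_⟩⟩
    -- Passing from row vectors to eigenvectors `y` with `y^*` on the left conjugates `τ`.
    have hy : (fun τ : ℂ => star (β • ω) + conj τ • star (β • ζ)) =
        fun τ => star (β • (ω + τ • ζ)) := by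
      ext1 τ
      rw [smul_add, star_add, smul_comm β τ, star_smul τ]
      rfl
    rw [hy]
    exact (h.smul hα hβ).sLaw
  · obtain ⟨ω, ζ, s, hω, hs, h⟩ := exists_rowLaw_of_left hAB hM hd htr' hy0 hy hyU
    obtain ⟨α, hα, hα1⟩ := exists_smul_euclNorm_eq_one hω
    obtain ⟨β, hβ, hβ1⟩ := exists_smul_euclNorm_eq_one hy0
    refine ⟨_, norm_pos_iff.mpr (mul_ne_zero (mul_ne_zero hα hβ) hs), Or.inr
      ⟨star (β • y), α • ω, α • ζ, by rwa [euclNorm_star], hα1, ?_, ?_⟩⟩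
    · rw [← Matrix.star_vecMul, Matrix.smul_vecMul, hyU, smul_zero, star_zero]
    · have hx : (fun τ : ℂ => α • ω + τ • α • ζ) = fun τ => α • (ω + τ • ζ) := by
        ext1 τ
        rw [smul_add, smul_comm α τ]
      rw [hx]
      exact (h.smul hα hβ).sLaw

end

end SingPencil

end

theorem mainTheorem5 (n k : ℕ) (A B : Matrix (Fin n) (Fin n) ℂ)
    (hsing : ¬ SingPencil.IsRegular A B) (hrank : SingPencil.nrank A B + k = n)
    (a b : Fin k → ℂ)
    (hD : SingPencil.IsRegular (Matrix.diagonal a) (Matrix.diagonal b))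
    (hγ : ∀ i, ¬ SingPencil.IsEigenvalue A B (SingPencil.gamma a b i))
    (hsimple : Function.Injective (SingPencil.gamma a b)) :
    SingPencil.Generically (n := n) (k := k) fun U V =>
      U.rank = k → V.rank = k →
        -- finite prescribed eigenvalues: both eigenvectors are constant unit vectors
        (∀ (i : Fin k) (lam : ℂ), SingPencil.gamma a b i = (lam : OnePoint ℂ) →
          ∃ c : ℝ, 0 < c ∧ ∃ x y : Fin n → ℂ,
            SingPencil.euclNorm x = 1 ∧ SingPencil.euclNorm y = 1 ∧
            SingPencil.SLaw (SingPencil.perturbed A U V a) (SingPencil.perturbed B U V b) lam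
              (fun _ => x) (fun _ => y) c) ∧
        -- random eigenvalues: all finite, one eigenvector constant, the other one linear
        (∀ μ : OnePoint ℂ, SingPencil.IsRandom A B U V a b μ →
          ∃ lam : ℂ, μ = (lam : OnePoint ℂ) ∧ ∃ c : ℝ, 0 < c ∧
            ((∃ x w z : Fin n → ℂ,
                SingPencil.euclNorm x = 1 ∧ SingPencil.euclNorm w = 1 ∧ Vᴴ *ᵥ x = 0 ∧
                SingPencil.SLaw (SingPencil.perturbed A U V a) (SingPencil.perturbed B U V b) lam
                  (fun _ => x) (fun τ => w + conj τ • z) c) ∨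
             (∃ y w z : Fin n → ℂ,
                SingPencil.euclNorm y = 1 ∧ SingPencil.euclNorm w = 1 ∧ Uᴴ *ᵥ y = 0 ∧
                SingPencil.SLaw (SingPencil.perturbed A U V a) (SingPencil.perturbed B U V b) lam
                  (fun τ => w + τ • z) (fun _ => y) c))) := by
  classical
  open SingPencil in
  obtain ⟨P, hP0, hP⟩ := exists_ne_zero_forall_trace_ne_zero hrank
  -- Otherwise `∞` is an eigenvalue of the original pencil and is not random by definition, so no
  -- condition is needed.
  let Pinf := if B.rank + k = n then borderedPoly k B else 1
  -- Infinite prescribed eigenvalues carry no claim, hence the default `1`.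
  let Pγ : Fin k → MvPolynomial ((Fin n × Fin k) ⊕ (Fin k × Fin n)) ℂ := fun i =>
    if b i = 0 then 1 else borderedPoly k (A - (a i / b i) • B)
  have hPinf : Pinf ≠ 0 := by
    simp only [Pinf]
    split_ifs with h
    · exact borderedPoly_ne_zero h
    · exact one_ne_zero
  have hPγ : ∀ i, Pγ i ≠ 0 := by
    intro i
    simp only [Pγ]
    split_ifs with h
    · exact one_ne_zero
    · refine borderedPoly_ne_zero (rank_add_eq_of_not_isEigenvalue hrank ?_)
      have := hγ i
      rwa [gamma, if_neg h] at this
  refine generically_of_ne_zero (P := P * Pinf * ∏ i, Pγ i)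
    (mul_ne_zero (mul_ne_zero hP0 hPinf) (Finset.prod_ne_zero_iff.mpr fun i _ => hPγ i))
    fun U V hUV _ _ => ?_
  rw [map_mul, map_mul, map_prod, mul_ne_zero_iff, mul_ne_zero_iff,
    Finset.prod_ne_zero_iff] at hUV
  obtain ⟨⟨hU, hUinf⟩, hUγ⟩ := hUV
  refine ⟨fun i lam hi => exists_sLaw_of_prescribed hrank hD hγ hsimple hi ?_, ?_⟩
  · obtain ⟨hb, hlam⟩ := ne_zero_and_div_eq_of_gamma_eq_coe hi
    have := hUγ i (Finset.mem_univ i)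
    simp only [Pγ] at this
    rwa [if_neg hb, hlam, eval_borderedPoly] at this
  · rintro μ ⟨⟨τ, hτ, hμ⟩, hAB, hne⟩
    rcases hμ with ⟨rfl, hlt⟩ | ⟨lam, rfl, hlt⟩
    · exfalso
      have hB := rank_add_eq_of_not_isEigenvalue_infty hrank hAB
      simp only [Pinf] at hUinf
      rw [if_pos hB, eval_borderedPoly] at hUinf
      -- At `∞` the matrix `B` plays the role of the pencil and `b` that of `d`; `b i = 0` would
      -- make `∞` prescribed.
      refine hUinf (det_bordered_eq_zero_of_null_vector
        (exists_null_vector_of_det_updated_eq_zero hB.le (d := b) (fun i hb => hne i ?_) hτ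
          (det_eq_zero_of_rank_lt (hlt.trans_le (nrank_le _ _)))))
      rw [gamma, if_pos hb]
    · have hM := rank_add_eq_of_not_isEigenvalue hrank hAB
      exact ⟨lam, rfl, exists_sLaw_of_simple hrank hM
        (fun i h0 => hne i (gamma_eq_coe_of_sub_eq_zero hD h0)) (hP U Vᴴ hU lam hM) hτ
        (det_eq_zero_of_rank_lt (hlt.trans_le (nrank_le _ _)))⟩
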